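/- **Setting.** Consider an episodic POMDP with horizon $H\ge 1$, measurable state space $\mathcal S$, measurable observation space $\mathcal O$, a finite action set $\mathcal A$ with $|\mathcal A|=A\ge 2$, a fixed initial state $s_0$, emission distributions $\mathbb O_h(\cdot\mid s)$, reward distributions $\mathbb Y_h(\cdot\mid s,a)$ on $[0,1]$ with means $r_h(s,a)$, and deterministic transitions $s_{h+1}=p_h(s_h,a_h)$. Only the rewards of steps $0,\dots,H-1$ count; for a given $K\ge 1$ the process runs for the steps $0,\dots,H+K-2$, so that $o_{h:h+K-1}$ is defined for every $h<H$. Let $Q^\star_H=0$, $Q^\star_h(s,a)=r_h(s,a)+\max_{a'}Q^\star_{h+1}(p_h(s,a),a')$, $V^\star_h(s)=\max_aQ^\star_h(s,a)$ and $\mathrm{gap}_h(s,a)=V^\star_h(s)-Q^\star_h(s,a)$. **Assumptions.** Let $\phi:\mathcal S\to\mathbb R^{d_s}$ be a state feature and $\psi:\mathcal O^K\to\mathbb R^d$ ($d\ge1$) a measurable feature with $\|\psi\|\le 1$. (i) Linear $Q^\star$: for all $h<H$ and $a$ there is $w^\star_{a;h}$ with $\|w^\star_{a;h}\|\le W$ and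 $Q^\star_h(s,a)=\langle w^\star_{a;h},\phi(s)\rangle$ for all $s$. (ii) Gap: every positive value $\mathrm{gap}_h(s,a)$ with $h<H$ is at least $\Delta$. (iii) $K$-step observability: for every $h<H$ there are a left-invertible matrix $G_h\in\mathbb R^{d\times d_s}$ and an (unknown) action sequence $a^\diamond_{h:h+K-2}\in\mathcal A^{K-1}$ with $\mathbb E[\psi(o_{h:h+K-1})\mid s_h=s;a^\diamond_{h:h+K-2}]=G_h\phi(s)$ for all $s$. Put $\Theta=W/\min_{h<H}\eta(G_h)$, where $\eta$ denotes the smallest singular value. **Algorithm** (parameters $\lambda,\varepsilon>0$, $M\ge1$). For each $h<H$ keep a data set $\mathcal D_h$, initially empty, of pairs $(\hat x,(y_a)_{a\in\mathcal A})$; put $\Sigma_h=\lambda I+\sum\hat x\hat x^\top$, $\hat\theta_{a;h}=\Sigma_h^{-1}\sum y_a\hat x$ (sums over $\mathcal D_h$) and $\|x\|_{\Sigma_h^{-1}}=(x^\top\Sigma_h^{-1}x)^{1/2}$. The *feature estimate* $\hat x_h(a_{0:h-1})\in\mathbb R^{dA^{K-1}}$ stacks, over all $b\in\mathcal A^{K-1}$,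 the mean of $\psi(o_{h:h+K-1})$ over $M$ fresh episodes executing $a_{0:h-1}$ and then $b$. The *reward estimate* $\hat r_h(a_{0:h})$ is the mean of the reward of step $h$ over $M$ fresh episodes executing $a_{0:h}$. *Exploring* at $(h,a_{0:h-1},\hat x)$ means: for every $a'\in\mathcal A$ in turn compute $y_{a'}=\hat r_h(a_{0:h-1},a')+\mathrm{ComputeV}(h+1;a_{0:h-1},a')$, then add $(\hat x,(y_{a'})_{a'})$ to $\mathcal D_h$. - $\mathrm{ComputeV}(h;a_{0:h-1})$: if $h=H$ return $0$. If $h=H-1$ return $\max_{a'}\hat r_h(a_{0:h-1},a')$. Otherwise form $\hat x=\hat x_h(a_{0:h-1})$. If $\|\hat x\|_{\Sigma_h^{-1}}\le\varepsilon$, let $a_h\in\arg\max_a\langle\hat\theta_{a;h},\hat x\rangle$ and return $\hat r_h(a_{0:h})+\mathrm{ComputeV}(h+1;a_{0:h})$. If not, explore at $(h,a_{0:h-1},\hat x)$ and return $\max_{a'}y_{a'}$. - Main loop: for $h=0,\dots,H-1$ form $\hat x_h(a_{0:h-1})$ and let $a_h\in\arg\max_a\langle\hat\theta_{a;h},\hat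 x_h(a_{0:h-1})\rangle$. If $\|\hat x_h(a_{0:h-1})\|_{\Sigma_h^{-1}}\le\varepsilon$ for all $h$, stop and return $a_{0:H-1}$. Otherwise explore at $(h,a_{0:h-1},\hat x_h(a_{0:h-1}))$ for the smallest $h$ violating this, and repeat. Ties in $\arg\max$ are broken by any measurable rule. A sample is one time step of interaction; every episode is charged its full length $H+K-1$. **Theorem.** There are universal constants $C>0$ and $q\in\mathbb N$ such that for all $H,K,d\ge 1$, $A\ge 2$, $\Theta\ge 1$, $0<\Delta\le\Theta$ and $0<\delta\le\frac12$ there are $\lambda,\varepsilon>0$ and $M\ge1$, depending only on these numbers, for which the following holds for every POMDP, features and tie-breaking rule as above. With probability at least $1-\delta$ the algorithm stops, returns an optimal action sequence $a^\star_{0:H-1}$ (one whose execution maximizes $\mathbb E_\pi[\sum_{h<H}r_h]$ over all history-dependent policies $\pi$), and has used at most $$C\,\log^q\!\Big(2+H+dA^{K}+\Theta+\tfrac1\Delta+\ln\tfrac1\delta\Big)\;H^5\,\Theta^5A^{3K-1}d^2\,\Delta^{-5}\ln(1/\delta)$$ samples. (If some gap is positive, then $\Delta\le\Theta$ holds automatically;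 $\Theta\ge1$ can always be achieved by enlarging $W$.) -/

import Mathlib

open MeasureTheory ProbabilityTheory
open scoped BigOperators Matrix

namespace HSEPOMDP

/-! ## Partially observable Markov decision processes

The horizon `H` is a separate parameter: only the rewards of the steps `h < H` count.  All families
are indexed by every `h : ℕ`, because a window of `K` observations that starts at a step `h < H` may
end after step `H - 1`.  The action set is `Fin A`. -/

/-- An episodic POMDP with state space `S`, observation space `O`, action set `Fin A`, transition
kernels `trans h a`, emission kernels `emit h`, reward kernels `rew h a` with rewards in `[0, 1]`,
and a fixed initial state. -/
structure POMDP (S O : Type*) [MeasurableSpace S] [MeasurableSpace O] (A : ℕ) where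
  trans : ℕ → Fin A → Kernel S S
  emit : ℕ → Kernel S O
  rew : ℕ → Fin A → Kernel S ℝ
  init : S
  trans_markov : ∀ h a, IsMarkovKernel (trans h a)
  emit_markov : ∀ h, IsMarkovKernel (emit h)
  rew_markov : ∀ h a, IsMarkovKernel (rew h a)
  rew_mem : ∀ h a s, ∀ᵐ r ∂(rew h a s), r ∈ Set.Icc (0 : ℝ) 1

attribute [instance] POMDP.trans_markov POMDP.emit_markov POMDP.rew_markov

namespace POMDP

variable {S O : Type*} [MeasurableSpace S] [MeasurableSpace O] {A : ℕ}

/-- The law of `((o_h, r_h), …, (o_{h+n-1}, r_{h+n-1}))`, as a kernel in the state `s_h`, when the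
actions `a 0, …, a (n-1)` are executed at the steps `h, …, h+n-1`. -/
noncomputable def episode (P : POMDP S O A) :
    (n : ℕ) → (h : ℕ) → (Fin n → Fin A) → Kernel S (Fin n → O × ℝ)
  | 0, _, _ => Kernel.const S (Measure.dirac Fin.elim0)
  | n + 1, h, a =>
    ((P.emit h ×ₖ P.rew h (a 0)) ×ₖ
      (episode P n (h + 1) (fun i => a i.succ) ∘ₖ P.trans h (a 0))).map
      (fun x => (Fin.cons x.1 x.2 : Fin (n + 1) → O × ℝ))

/-- The law of `(o_h, …, o_{h+n})`, as a kernel in the state `s_h`, when the actions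
`b 0, …, b (n-1)` are executed at the steps `h, …, h+n-1`. -/
noncomputable def window (P : POMDP S O A) :
    (n : ℕ) → (h : ℕ) → (Fin n → Fin A) → Kernel S (Fin (n + 1) → O)
  | 0, h, _ => (P.emit h).map (fun o => fun _ => o)
  | n + 1, h, b =>
    (P.emit h ×ₖ (window P n (h + 1) (fun i => b i.succ) ∘ₖ P.trans h (b 0))).map
      (fun x => (Fin.cons x.1 x.2 : Fin (n + 2) → O))

theorem measurable_cons {X : Type*} [MeasurableSpace X] (n : ℕ) :
    Measurable (fun x : X × (Fin n → X) => (Fin.cons x.1 x.2 : Fin (n + 1) → X)) := by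
  refine measurable_pi_lambda _ (fun i => ?_)
  refine Fin.cases ?_ (fun j => ?_) i
  · simpa using measurable_fst
  · simpa [Function.comp_def] using (measurable_pi_apply j).comp measurable_snd

instance episode_markov (P : POMDP S O A) (n h : ℕ) (a : Fin n → Fin A) :
    IsMarkovKernel (P.episode n h a) := by
  induction n generalizing h with
  | zero => unfold episode; infer_instance
  | succ n ih =>
    unfold episode
    have := ih (h + 1) (fun i => a i.succ)
    exact Kernel.IsMarkovKernel.map _ (measurable_cons n)

instance window_markov (P : POMDP S O A) (n h : ℕ) (b : Fin n → Fin A) :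
    IsMarkovKernel (P.window n h b) := by
  induction n generalizing h with
  | zero =>
    unfold window
    exact Kernel.IsMarkovKernel.map _ (measurable_pi_lambda _ (fun _ => measurable_id))
  | succ n ih =>
    unfold window
    have := ih (h + 1) (fun i => b i.succ)
    exact Kernel.IsMarkovKernel.map _ (measurable_cons (n + 1))

/-- The mean reward `r_h(s, a)`. -/
noncomputable def meanRew (P : POMDP S O A) (h : ℕ) (s : S) (a : Fin A) : ℝ :=
  ∫ r, r ∂(P.rew h a s)

/-- The transitions are deterministic, given by the maps `p h`. -/
def IsDeterministic (P : POMDP S O A) (p : ℕ → S → Fin A → S) : Prop :=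
  ∀ h a s, P.trans h a s = Measure.dirac (p h s a)

/-- `qStep P p n h` is the optimal `Q`-function at step `h` when `n` steps remain. -/
noncomputable def qStep (P : POMDP S O A) (p : ℕ → S → Fin A → S) : ℕ → ℕ → S → Fin A → ℝ
  | 0, _, _, _ => 0
  | n + 1, h, s, a => P.meanRew h s a + ⨆ a' : Fin A, qStep P p n (h + 1) (p h s a) a'

/-- The optimal `Q`-function: `Q_H = 0` and `Q_h(s,a) = r_h(s,a) + max_{a'} Q_{h+1}(p_h(s,a), a')`
for `h < H`. -/
noncomputable def qStar (P : POMDP S O A) (p : ℕ → S → Fin A → S) (H h : ℕ) (s : S)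
    (a : Fin A) : ℝ :=
  qStep P p (H - h) h s a

/-- `V_h(s) = max_a Q_h(s,a)`. -/
noncomputable def vStar (P : POMDP S O A) (p : ℕ → S → Fin A → S) (H h : ℕ) (s : S) : ℝ :=
  ⨆ a : Fin A, qStar P p H h s a

/-- `gap_h(s,a) = V_h(s) - Q_h(s,a)`. -/
noncomputable def gap (P : POMDP S O A) (p : ℕ → S → Fin A → S) (H h : ℕ) (s : S)
    (a : Fin A) : ℝ :=
  vStar P p H h s - qStar P p H h s a

/-- A history-dependent policy: it picks an action from the past observations, actions and rewards
and the current observation. The current step is the length of the history. -/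
abbrev Policy (O : Type*) (A : ℕ) := List (O × Fin A × ℝ) → O → Fin A

/-- The expected sum of the rewards of the next `n` steps under the policy `π`, from step `h` with
history `l` in the latent state `s`. -/
noncomputable def valueFrom (P : POMDP S O A) (π : Policy O A) :
    ℕ → ℕ → List (O × Fin A × ℝ) → S → ℝ
  | 0, _, _, _ => 0
  | n + 1, h, l, s =>
    ∫ o, ∫ r, (r + ∫ s', valueFrom P π n (h + 1) (l ++ [(o, π l o, r)]) s'
      ∂(P.trans h (π l o) s)) ∂(P.rew h (π l o) s) ∂(P.emit h s)

/-- The value `E_π[∑_{h < H} r_h]` of a policy. -/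
noncomputable def value (P : POMDP S O A) (H : ℕ) (π : Policy O A) : ℝ :=
  P.valueFrom π H 0 [] P.init

/-- The policy that executes the actions of the list `l` in turn. -/
def openLoop (O : Type*) [NeZero A] (l : List (Fin A)) : Policy O A :=
  fun hist _ => l.getD hist.length 0

/-- `l` is an optimal action sequence `a_0, …, a_{H-1}`: executing it is optimal among all
policies. -/
def IsOptimalActions [NeZero A] (P : POMDP S O A) (H : ℕ) (l : List (Fin A)) : Prop :=
  l.length = H ∧ ∀ π : Policy O A, P.value H π ≤ P.value H (openLoop O l)

end POMDP

/-- The smallest singular value of a matrix. -/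
noncomputable def smallestSingularValue {d ds : ℕ} (G : Matrix (Fin d) (Fin ds) ℝ) : ℝ :=
  (Matrix.toEuclideanLin G).singularValues (min d ds - 1)

/-! ## Running an algorithm against the POMDP

With `k = K - 1`, an episode consists of the `H + k` steps `0, …, H + k - 1`; this is long enough
for a window of `K` observations that starts at any step `h < H`. -/

/-- The actions of one episode. -/
abbrev Plan (H k A : ℕ) := Fin (H + k) → Fin A

/-- The observations and the rewards of one episode. -/
abbrev Outcome (H k : ℕ) (O : Type*) := Fin (H + k) → O × ℝ

/-- `ω (n, a)` is the outcome of the `n`-th episode if the plan `a` is executed in it. An algorithm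
reads one entry for each `n`. -/
abbrev Tape (H k A : ℕ) (O : Type*) := ℕ × Plan H k A → Outcome H k O

/-- The law of the tape: independent episodes, each started in the initial state. -/
noncomputable def tapeLaw {S O : Type*} [MeasurableSpace S] [MeasurableSpace O] {A : ℕ}
    (P : POMDP S O A) (H k : ℕ) : Measure (Tape H k A O) :=
  Measure.infinitePi (fun i : ℕ × Plan H k A => P.episode (H + k) 0 i.2 P.init)

instance tapeLaw_probability {S O : Type*} [MeasurableSpace S] [MeasurableSpace O] {A : ℕ}
    (P : POMDP S O A) (H k : ℕ) : IsProbabilityMeasure (tapeLaw P H k) := by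
  unfold tapeLaw; infer_instance

/-! ## The algorithm -/

/-- Stacked features: one block of dimension `d` for each sequence of `k` actions. -/
abbrev Feat (k A d : ℕ) := (Fin k → Fin A) × Fin d → ℝ

/-- A level data set: pairs of an estimated feature `x̂` and the values `(y_a)_a`. The list stands for
`D_h` (the first components) and for all `D_{a;h}` (the pairs `(x̂, y_a)`). -/
abbrev Dataset (k A d : ℕ) := List (Feat k A d × (Fin A → ℝ))

/-- `Σ(D) = ∑_j x̂_j x̂_jᵀ + λ I`. -/
noncomputable def sigmaMat {k A d : ℕ} (lam : ℝ) (D : Dataset k A d) :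
    Matrix ((Fin k → Fin A) × Fin d) ((Fin k → Fin A) × Fin d) ℝ :=
  (D.map (fun e => Matrix.vecMulVec e.1 e.1)).sum + lam • 1

/-- `θ̂_a(D) = Σ(D)⁻¹ ∑_j y_{a,j} x̂_j`. -/
noncomputable def thetaHat {k A d : ℕ} (lam : ℝ) (D : Dataset k A d) (a : Fin A) : Feat k A d :=
  (sigmaMat lam D)⁻¹ *ᵥ (D.map (fun e => e.2 a • e.1)).sum

/-- `‖x‖_{Σ(D)⁻¹}`. -/
noncomputable def sigmaInvNorm {k A d : ℕ} (lam : ℝ) (D : Dataset k A d) (x : Feat k A d) : ℝ :=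
  Real.sqrt (x ⬝ᵥ ((sigmaMat lam D)⁻¹ *ᵥ x))

/-- The state of the algorithm: the number of episodes executed so far and the data sets. -/
structure AlgState (H k A d : ℕ) where
  episodes : ℕ
  data : Fin H → Dataset k A d

/-- The inputs of the algorithm: the parameters `λ`, `ε`, `M`, the feature `ψ` of windows of `k + 1`
observations, and the rule `amax` that selects a maximizer. -/
structure AlgInput (k A d : ℕ) (O : Type*) where
  lam : ℝ
  eps : ℝ
  M : ℕ
  ψ : (Fin (k + 1) → O) → EuclideanSpace ℝ (Fin d)
  amax : (Fin A → ℝ) → Fin A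

section Algorithm

variable {H k A d : ℕ} [NeZero A] {O : Type*} (I : AlgInput k A d O) (ω : Tape H k A O)

/-- Execute the actions of `l`, then an arbitrary fixed action until the episode ends. -/
def planOf (H k : ℕ) (l : List (Fin A)) : Plan H k A := fun t => l.getD t 0

/-- The observations `o_h, …, o_{h+k}` of an episode. -/
def obsWindow (h : Fin H) (x : Outcome H k O) : Fin (k + 1) → O :=
  fun i => (x ⟨h + i, by omega⟩).1

/-- The reward `r_h` of an episode. -/
def rewardAt (h : Fin H) (x : Outcome H k O) : ℝ :=
  (x ⟨h, by omega⟩).2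

/-- The estimated stacked feature after the actions `l = a_{0:h-1}`: for each sequence `b` of `k`
actions, the mean of `ψ(o_{h:h+k})` over `M` fresh episodes that execute `l` and then `b`. It uses
the `M * A ^ k` episodes `n, …, n + M * A ^ k - 1`. -/
noncomputable def featEst (h : Fin H) (l : List (Fin A)) (n : ℕ) : Feat k A d :=
  fun bj => (∑ i : Fin I.M, I.ψ (obsWindow h
    (ω (n + I.M * (finFunctionFinEquiv bj.1 : Fin (A ^ k)) + i,
      planOf H k (l ++ List.ofFn bj.1)))) bj.2) / I.M

/-- The mean of the reward `r_h` over `M` fresh episodes `n, …, n + M - 1` that execute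
`l = a_{0:h}`. -/
noncomputable def rewEst (h : Fin H) (l : List (Fin A)) (n : ℕ) : ℝ :=
  (∑ i : Fin I.M, rewardAt h (ω (n + i, planOf H k l))) / I.M

/-- The step taken when the feature `x` after `l = a_{0:h-1}` is not covered by the data: for each
action `a'` in turn, estimate the reward, add the value returned by `next` after `l, a'` to get
`y_{a'}`; finally add `(x, y)` to the data of level `h`. -/
noncomputable def explore (h : Fin H) (l : List (Fin A)) (x : Feat k A d)
    (next : List (Fin A) → AlgState H k A d → ℝ × AlgState H k A d) (st : AlgState H k A d) :
    (Fin A → ℝ) × AlgState H k A d :=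
  let res := (List.finRange A).foldl
    (fun (acc : (Fin A → ℝ) × AlgState H k A d) a' =>
      let r := rewEst I ω h (l ++ [a']) acc.2.episodes
      let out := next (l ++ [a']) { acc.2 with episodes := acc.2.episodes + I.M }
      (Function.update acc.1 a' (r + out.1), out.2))
    ((fun _ => 0), st)
  (res.1, { res.2 with data := Function.update res.2.data h (res.2.data h ++ [(x, res.1)]) })

/-- The subroutine Compute-`V` at step `h`, after the actions `l = a_{0:h-1}`, with `r = H - h` steps
remaining; it returns `0` at `h = H`. -/
noncomputable def computeV : (r h : ℕ) → h + r = H → List (Fin A) → AlgState H k A d →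
    ℝ × AlgState H k A d
  | 0, _, _, _, st => (0, st)
  | 1, h, hr, l, st =>
    (⨆ a' : Fin A, rewEst I ω ⟨h, by omega⟩ (l ++ [a']) (st.episodes + I.M * a'),
      { st with episodes := st.episodes + I.M * A })
  | r + 2, h, hr, l, st =>
    let hh : Fin H := ⟨h, by omega⟩
    let x := featEst I ω hh l st.episodes
    let st₁ : AlgState H k A d := { st with episodes := st.episodes + I.M * A ^ k }
    if sigmaInvNorm I.lam (st₁.data hh) x ≤ I.eps then
      let a := I.amax (fun a => thetaHat I.lam (st₁.data hh) a ⬝ᵥ x)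
      let rhat := rewEst I ω hh (l ++ [a]) st₁.episodes
      let out := computeV (r + 1) (h + 1) (by omega) (l ++ [a])
        { st₁ with episodes := st₁.episodes + I.M }
      (rhat + out.1, out.2)
    else
      let out := explore I ω hh l x
        (fun l' st' => computeV (r + 1) (h + 1) (by omega) l' st') st₁
      (⨆ a : Fin A, out.1 a, out.2)

/-- The loop over the levels `h, …, H - 1` of the main routine, with `r = H - h` levels to go: it
estimates the feature after `l = a_{0:h-1}` and appends the greedy action `a_h`. The first level
whose feature is not covered by the data is recorded, with its actions and its feature. -/
noncomputable def rollout : (r h : ℕ) → h + r = H → List (Fin A) →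
    Option (Fin H × List (Fin A) × Feat k A d) → AlgState H k A d →
    Option (Fin H × List (Fin A) × Feat k A d) × List (Fin A) × AlgState H k A d
  | 0, _, _, l, bad, st => (bad, l, st)
  | r + 1, h, hr, l, bad, st =>
    let hh : Fin H := ⟨h, by omega⟩
    let x := featEst I ω hh l st.episodes
    let a := I.amax (fun a => thetaHat I.lam (st.data hh) a ⬝ᵥ x)
    let bad' := if bad = none ∧ ¬ sigmaInvNorm I.lam (st.data hh) x ≤ I.eps
      then some (hh, l, x) else bad
    rollout r (h + 1) (by omega) (l ++ [a]) bad'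
      { st with episodes := st.episodes + I.M * A ^ k }

/-- The main loop, run for at most `n` iterations: the returned action sequence and the final
state, or `none` if the loop has not stopped by then. -/
noncomputable def mainLoop : ℕ → AlgState H k A d → Option (List (Fin A) × AlgState H k A d)
  | 0, _ => none
  | n + 1, st =>
    match rollout I ω H 0 (Nat.zero_add H) [] none st with
    | (none, l, st') => some (l, st')
    | (some (h, l, x), _, st') =>
      mainLoop n (explore I ω h l x
        (fun l' st'' => computeV I ω (H - (h + 1)) (h + 1) (by omega) l' st'') st').2

/-- On the tape `ω` the algorithm, started with empty data sets, stops and returns the actions `l`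
after `N` samples. Every episode is charged its `H + k = H + K - 1` steps. -/
def Outputs (l : List (Fin A)) (N : ℕ) : Prop :=
  ∃ (n : ℕ) (st : AlgState H k A d),
    mainLoop I ω n { episodes := 0, data := fun _ => [] } = some (l, st) ∧
    N = st.episodes * (H + k)

end Algorithm

end HSEPOMDP

/-! The features of a data set were all uncovered when they were added, so each of them multiplies
`det Σ` by more than `1 + ε²`; as the features are bounded, a data set has at most about
`d A^(K-1) log` entries, and there are at most `H` times as many explorations, each of them costing
at most `(A + 1) H M (A^(K-1) + A)` episodes.

A left inverse turns linearity of `Q*` in the state feature into linearity in the mean future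
feature under the unknown actions, with coefficients of norm at most `Θ`. As long as the estimates
are accurate, induction on the number of remaining steps shows that every stored value is within
`2 e` of a linear function of its feature, so that ridge regression predicts `Q*` on covered
features up to less than `Δ / 2`. The greedy action then has gap `0`, the induction goes on, and the
output is optimal.

The tape makes the accuracy of the estimates a matter of Hoeffding's inequality and a union bound:
feature estimates are averages of functions bounded by `Θ`; sums of reward estimates along the
executed actions are treated as a whole, since Hoeffding's inequality for the sum of the `H` levels
saves a factor `H` over a bound for each level. -/

namespace HSEPOMDP

/-! ## Linear algebra -/

section LinearMap

variable {E F : Type*} [NormedAddCommGroup E] [InnerProductSpace ℝ E] [NormedAddCommGroup F]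
  [InnerProductSpace ℝ F]

theorem norm_map_sq_eq_sum_eigenvalues_mul [FiniteDimensional ℝ E] [FiniteDimensional ℝ F]
    (T : E →ₗ[ℝ] F) {n : ℕ} (hn : Module.finrank ℝ E = n) (x : E) :
    ‖T x‖ ^ 2 = ∑ i, T.isSymmetric_adjoint_comp_self.eigenvalues hn i *
      inner ℝ (T.isSymmetric_adjoint_comp_self.eigenvectorBasis hn i) x ^ 2 := by
  set hS := T.isSymmetric_adjoint_comp_self
  set b := hS.eigenvectorBasis hn
  have hcoord : ∀ i, inner ℝ (LinearMap.adjoint T (T x)) (b i)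
      = hS.eigenvalues hn i * inner ℝ (b i) x := fun i => by
    rw [← LinearMap.comp_apply, hS x (b i), hS.apply_eigenvectorBasis hn i, inner_smul_right,
      real_inner_comm]
    rfl
  rw [← real_inner_self_eq_norm_sq, ← LinearMap.adjoint_inner_left, ← b.sum_inner_mul_inner]
  exact Finset.sum_congr rfl fun i _ => by rw [hcoord]; ring

theorem singularValues_mul_norm_le [FiniteDimensional ℝ E] [FiniteDimensional ℝ F]
    (T : E →ₗ[ℝ] F) (x : E) :
    T.singularValues (Module.finrank ℝ E - 1) * ‖x‖ ≤ ‖T x‖ := by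
  refine le_of_sq_le_sq ?_ (norm_nonneg _)
  rw [norm_map_sq_eq_sum_eigenvalues_mul T rfl, mul_pow,
    ← (T.isSymmetric_adjoint_comp_self.eigenvectorBasis rfl).sum_sq_inner_right x, Finset.mul_sum]
  refine Finset.sum_le_sum fun i _ => mul_le_mul_of_nonneg_right ?_ (sq_nonneg _)
  rw [← T.sq_singularValues_fin rfl i]
  exact pow_le_pow_left₀ (T.singularValues_nonneg _) (T.singularValues_antitone (by omega)) 2

theorem exists_dual_comp_eq {T : E →ₗ[ℝ] F} {c : ℝ} (hc : 0 < c) (hT : ∀ x, c * ‖x‖ ≤ ‖T x‖)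
    (g : StrongDual ℝ E) : ∃ f : StrongDual ℝ F, ‖f‖ ≤ ‖g‖ / c ∧ ∀ x, f (T x) = g x := by
  have hinj : Function.Injective T := (injective_iff_map_eq_zero T).2 fun x hx => by
    have := hT x
    rw [hx, norm_zero] at this
    exact norm_eq_zero.1 (le_antisymm (nonpos_of_mul_nonpos_right this hc) (norm_nonneg x))
  let e := LinearEquiv.ofInjective T hinj
  have hbound : ∀ y, ‖(g.toLinearMap ∘ₗ e.symm.toLinearMap) y‖ ≤ ‖g‖ / c * ‖y‖ := fun y => by
    obtain ⟨x, rfl⟩ := e.surjective y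
    calc ‖(g.toLinearMap ∘ₗ e.symm.toLinearMap) (e x)‖ = ‖g x‖ := by simp
      _ ≤ ‖g‖ * ‖x‖ := g.le_opNorm x
      _ ≤ ‖g‖ * (‖T x‖ / c) := by gcongr; rw [le_div_iff₀' hc]; exact hT x
      _ = ‖g‖ / c * ‖e x‖ := by rw [Submodule.coe_norm, LinearEquiv.ofInjective_apply]; ring
  obtain ⟨f, hf, hnorm⟩ := exists_extension_norm_eq _ (LinearMap.mkContinuous _ _ hbound)
  refine ⟨f, hnorm.trans_le (LinearMap.mkContinuous_norm_le _ (by positivity) _), fun x => ?_⟩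
  simpa [e] using hf (e x)

theorem exists_inner_map_eq [CompleteSpace E] [CompleteSpace F] {T : E →ₗ[ℝ] F} {c : ℝ}
    (hc : 0 < c) (hT : ∀ x, c * ‖x‖ ≤ ‖T x‖) (w : E) :
    ∃ θ : F, ‖θ‖ ≤ ‖w‖ / c ∧ ∀ x, inner ℝ θ (T x) = inner ℝ w x := by
  obtain ⟨f, hnorm, hf⟩ := exists_dual_comp_eq hc hT (InnerProductSpace.toDual ℝ E w)
  refine ⟨(InnerProductSpace.toDual ℝ F).symm f, by simpa using hnorm, fun x => ?_⟩
  rw [InnerProductSpace.toDual_symm_apply, hf, InnerProductSpace.toDual_apply_apply]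

end LinearMap

theorem abs_sum_mul_le_sqrt_mul_sqrt {ι : Type*} (s : Finset ι) (f g : ι → ℝ) :
    |∑ i ∈ s, f i * g i| ≤ √(∑ i ∈ s, f i ^ 2) * √(∑ i ∈ s, g i ^ 2) := by
  rw [← Real.sqrt_mul (Finset.sum_nonneg fun i _ => sq_nonneg (f i))]
  exact Real.abs_le_sqrt (Finset.sum_mul_sq_le_sq_mul_sq s f g)

section Matrix

variable {ι : Type*} [Fintype ι]

theorem abs_dotProduct_le (θ z : ι → ℝ) : |θ ⬝ᵥ z| ≤ √(θ ⬝ᵥ θ) * √(z ⬝ᵥ z) := by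
  simpa [dotProduct, pow_two] using abs_sum_mul_le_sqrt_mul_sqrt Finset.univ θ z

theorem det_add_vecMulVec_self [DecidableEq ι] {S : Matrix ι ι ℝ} (hS : IsUnit S.det)
    (x : ι → ℝ) :
    (S + Matrix.vecMulVec x x).det = S.det * (1 + x ⬝ᵥ (S⁻¹ *ᵥ x)) := by
  rw [Matrix.vecMulVec_eq Unit, Matrix.det_add_replicateCol_mul_replicateRow hS, Matrix.mul_assoc]
  simp [Matrix.mul_apply, Matrix.mulVec, dotProduct]

theorem eigenvalues_le_of_forall_dotProduct_mulVec_le [DecidableEq ι] {S : Matrix ι ι ℝ}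
    (hS : S.IsHermitian) {c : ℝ} (hc : ∀ v : ι → ℝ, v ⬝ᵥ (S *ᵥ v) ≤ c * (v ⬝ᵥ v)) (i : ι) :
    hS.eigenvalues i ≤ c := by
  set b : ι → ℝ := ⇑(hS.eigenvectorBasis i)
  have hb : b ⬝ᵥ b = 1 := by
    have h := real_inner_self_eq_norm_sq (hS.eigenvectorBasis i)
    rw [hS.eigenvectorBasis.orthonormal.1 i, EuclideanSpace.inner_eq_star_dotProduct] at h
    simpa using h
  simpa [b, hS.mulVec_eigenvectorBasis i, dotProduct_smul, hb] using hc b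

theorem det_le_pow_of_forall_dotProduct_mulVec_le [DecidableEq ι] {S : Matrix ι ι ℝ}
    (hS : S.PosSemidef) {c : ℝ} (hc : ∀ v : ι → ℝ, v ⬝ᵥ (S *ᵥ v) ≤ c * (v ⬝ᵥ v)) :
    S.det ≤ c ^ Fintype.card ι := by
  rw [hS.isHermitian.det_eq_prod_eigenvalues, ← Finset.card_univ, ← Finset.prod_const]
  exact Finset.prod_le_prod (fun i _ => hS.eigenvalues_nonneg i) fun i _ =>
    eigenvalues_le_of_forall_dotProduct_mulVec_le hS.isHermitian hc i

end Matrix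

theorem abs_sum_mul_le_sqrt_card {ι : Type*} (s : Finset ι) (f g : ι → ℝ) {e : ℝ} (he : 0 ≤ e)
    (hf : ∀ i ∈ s, |f i| ≤ e) :
    |∑ i ∈ s, f i * g i| ≤ √s.card * e * √(∑ i ∈ s, g i ^ 2) := by
  have hsq : ∑ i ∈ s, f i ^ 2 ≤ s.card * e ^ 2 := by
    rw [← nsmul_eq_mul]
    exact Finset.sum_le_card_nsmul _ _ _ fun i hi => sq_le_sq.2 ((hf i hi).trans (le_abs_self e))
  calc |∑ i ∈ s, f i * g i| ≤ √(∑ i ∈ s, f i ^ 2) * √(∑ i ∈ s, g i ^ 2) :=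
        abs_sum_mul_le_sqrt_mul_sqrt s f g
    _ ≤ √(s.card * e ^ 2) * √(∑ i ∈ s, g i ^ 2) := by gcongr
    _ = √s.card * e * √(∑ i ∈ s, g i ^ 2) := by
        rw [Real.sqrt_mul (Nat.cast_nonneg _), Real.sqrt_sq he]

/-! ## Ridge regression on the collected data -/

section Ridge

variable {k A d : ℕ}

theorem sigmaMat_append (lam : ℝ) (D : Dataset k A d) (c : Feat k A d × (Fin A → ℝ)) :
    sigmaMat lam (D ++ [c]) = sigmaMat lam D + Matrix.vecMulVec c.1 c.1 := by
  simp only [sigmaMat, List.map_append, List.sum_append, List.map_cons, List.map_nil,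
    List.sum_singleton]
  abel

theorem dotProduct_sigmaMat_mulVec (lam : ℝ) (D : Dataset k A d) (z v : Feat k A d) :
    z ⬝ᵥ (sigmaMat lam D *ᵥ v)
      = (D.map (fun c => (z ⬝ᵥ c.1) * (v ⬝ᵥ c.1))).sum + lam * (z ⬝ᵥ v) := by
  unfold sigmaMat
  induction D with
  | nil => simp [Matrix.smul_mulVec]
  | cons c D ih =>
    simp only [List.map_cons, List.sum_cons]
    rw [add_assoc, Matrix.add_mulVec, dotProduct_add, ih, Matrix.vecMulVec_mulVec, add_assoc]
    simp [dotProduct_smul, dotProduct_comm v, mul_comm]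

theorem sigmaMat_posDef {lam : ℝ} (hlam : 0 < lam) (D : Dataset k A d) :
    (sigmaMat lam D).PosDef := by
  induction D using List.reverseRecOn with
  | nil =>
    simp only [sigmaMat, List.map_nil, List.sum_nil, zero_add]
    exact Matrix.PosDef.one.smul hlam
  | append_singleton D c ih =>
    rw [sigmaMat_append]
    exact ih.add_posSemidef (by simpa using Matrix.posSemidef_vecMulVec_self_star c.1)

theorem isUnit_det_sigmaMat {lam : ℝ} (hlam : 0 < lam) (D : Dataset k A d) :
    IsUnit (sigmaMat lam D).det :=
  (Matrix.isUnit_iff_isUnit_det _).1 (sigmaMat_posDef hlam D).isUnit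

theorem sigmaMat_mulVec_inv_mulVec {lam : ℝ} (hlam : 0 < lam) (D : Dataset k A d)
    (v : Feat k A d) : sigmaMat lam D *ᵥ ((sigmaMat lam D)⁻¹ *ᵥ v) = v := by
  rw [Matrix.mulVec_mulVec, Matrix.mul_nonsing_inv _ (isUnit_det_sigmaMat hlam D),
    Matrix.one_mulVec]

section Prediction

variable {lam : ℝ} (hlam : 0 < lam) (D : Dataset k A d) (x : Feat k A d)

include hlam

theorem sigmaInvNorm_eq_sqrt :
    sigmaInvNorm lam D x = √((D.map (fun c => (((sigmaMat lam D)⁻¹ *ᵥ x) ⬝ᵥ c.1) ^ 2)).sum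
      + lam * (((sigmaMat lam D)⁻¹ *ᵥ x) ⬝ᵥ ((sigmaMat lam D)⁻¹ *ᵥ x))) := by
  simp only [pow_two]
  rw [sigmaInvNorm, ← dotProduct_sigmaMat_mulVec, sigmaMat_mulVec_inv_mulVec hlam,
    dotProduct_comm]

theorem thetaHat_dotProduct (a : Fin A) :
    thetaHat lam D a ⬝ᵥ x
      = (D.map (fun c => c.2 a * (((sigmaMat lam D)⁻¹ *ᵥ x) ⬝ᵥ c.1))).sum := by
  have hsymm : (sigmaMat lam D)⁻¹ᵀ = (sigmaMat lam D)⁻¹ := by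
    simpa using (sigmaMat_posDef hlam D).isHermitian.inv.eq
  rw [thetaHat, dotProduct_comm, Matrix.dotProduct_mulVec, ← Matrix.mulVec_transpose, hsymm]
  clear hsymm
  generalize (sigmaMat lam D)⁻¹ *ᵥ x = z
  induction D with
  | nil => simp
  | cons c D ih => simp [dotProduct_add, ih]

theorem thetaHat_dotProduct_sub (a : Fin A) (θ : Feat k A d) :
    thetaHat lam D a ⬝ᵥ x - θ ⬝ᵥ x
      = (D.map (fun c => (c.2 a - θ ⬝ᵥ c.1) * (((sigmaMat lam D)⁻¹ *ᵥ x) ⬝ᵥ c.1))).sum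
        - lam * (θ ⬝ᵥ ((sigmaMat lam D)⁻¹ *ᵥ x)) := by
  have hθ := dotProduct_sigmaMat_mulVec lam D θ ((sigmaMat lam D)⁻¹ *ᵥ x)
  rw [sigmaMat_mulVec_inv_mulVec hlam] at hθ
  rw [hθ, thetaHat_dotProduct hlam, ← sub_sub]
  congr 1
  rw [sub_eq_iff_eq_add, ← List.sum_map_add]
  simp only [sub_mul, sub_add_cancel]

theorem sqrt_mul_sqrt_dotProduct_self_le_sigmaInvNorm :
    √lam * √(((sigmaMat lam D)⁻¹ *ᵥ x) ⬝ᵥ ((sigmaMat lam D)⁻¹ *ᵥ x)) ≤ sigmaInvNorm lam D x := by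
  rw [sigmaInvNorm_eq_sqrt hlam, ← Real.sqrt_mul hlam.le]
  exact Real.sqrt_le_sqrt (le_add_of_nonneg_left
    (List.sum_nonneg (List.forall_mem_map.2 fun c _ => sq_nonneg _)))

theorem abs_sum_map_mul_le_sigmaInvNorm (f : Feat k A d × (Fin A → ℝ) → ℝ) {e : ℝ} (he : 0 ≤ e)
    (hf : ∀ c ∈ D, |f c| ≤ e) :
    |(D.map (fun c => f c * (((sigmaMat lam D)⁻¹ *ᵥ x) ⬝ᵥ c.1))).sum|
      ≤ √D.length * e * sigmaInvNorm lam D x := by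
  set z := (sigmaMat lam D)⁻¹ *ᵥ x
  have hz : 0 ≤ z ⬝ᵥ z := by simpa using dotProduct_self_star_nonneg z
  have h := abs_sum_mul_le_sqrt_card Finset.univ (fun i : Fin D.length => f D[i.1])
    (fun i => z ⬝ᵥ D[i.1].1) he fun i _ => hf _ (List.getElem_mem _)
  rw [Fin.sum_univ_fun_getElem D (fun c => f c * (z ⬝ᵥ c.1)),
    Fin.sum_univ_fun_getElem D (fun c => (z ⬝ᵥ c.1) ^ 2), Finset.card_univ, Fintype.card_fin] at h
  refine h.trans ?_
  rw [sigmaInvNorm_eq_sqrt hlam]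
  gcongr
  exact le_add_of_nonneg_right (by positivity)

theorem abs_thetaHat_dotProduct_sub_le (a : Fin A) (θ : Feat k A d) {e : ℝ} (he : 0 ≤ e)
    (hD : ∀ c ∈ D, |c.2 a - θ ⬝ᵥ c.1| ≤ e) :
    |thetaHat lam D a ⬝ᵥ x - θ ⬝ᵥ x|
      ≤ sigmaInvNorm lam D x * (√D.length * e + √lam * √(θ ⬝ᵥ θ)) := by
  set z := (sigmaMat lam D)⁻¹ *ᵥ x
  have hdata := abs_sum_map_mul_le_sigmaInvNorm hlam D x (fun c => c.2 a - θ ⬝ᵥ c.1) he hD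
  have hbias : |lam * (θ ⬝ᵥ z)| ≤ √lam * √(θ ⬝ᵥ θ) * sigmaInvNorm lam D x :=
    calc |lam * (θ ⬝ᵥ z)| = √lam * √lam * |θ ⬝ᵥ z| := by
          rw [abs_mul, abs_of_pos hlam, Real.mul_self_sqrt hlam.le]
      _ ≤ √lam * √lam * (√(θ ⬝ᵥ θ) * √(z ⬝ᵥ z)) := by gcongr; exact abs_dotProduct_le θ z
      _ = √lam * √(θ ⬝ᵥ θ) * (√lam * √(z ⬝ᵥ z)) := by ring
      _ ≤ √lam * √(θ ⬝ᵥ θ) * sigmaInvNorm lam D x := by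
          gcongr; exact sqrt_mul_sqrt_dotProduct_self_le_sigmaInvNorm hlam D x
  rw [thetaHat_dotProduct_sub hlam]
  refine (abs_sub _ _).trans ((add_le_add hdata hbias).trans_eq ?_)
  ring

end Prediction

/-- Every feature of the data set has squared norm at most `R` and was, when it was added, not
covered by the earlier ones: its norm `‖·‖_{Σ⁻¹}` exceeded `eps`. -/
inductive Uncovered (lam eps R : ℝ) : Dataset k A d → Prop
  | nil : Uncovered lam eps R []
  | append (D : Dataset k A d) (x : Feat k A d) (y : Fin A → ℝ) : Uncovered lam eps R D →
      x ⬝ᵥ x ≤ R → ¬ sigmaInvNorm lam D x ≤ eps → Uncovered lam eps R (D ++ [(x, y)])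

namespace Uncovered

variable {lam eps R : ℝ} {D : Dataset k A d}

theorem le_det (h : Uncovered lam eps R D) (hlam : 0 < lam) (heps : 0 ≤ eps) :
    lam ^ (A ^ k * d) * (1 + eps ^ 2) ^ D.length ≤ (sigmaMat lam D).det := by
  induction h with
  | nil => simp [sigmaMat]
  | append D x y _ _ hx ih =>
    have hx' : eps ^ 2 ≤ x ⬝ᵥ ((sigmaMat lam D)⁻¹ *ᵥ x) :=
      ((Real.lt_sqrt heps).1 (not_le.1 hx)).le
    rw [sigmaMat_append, det_add_vecMulVec_self (isUnit_det_sigmaMat hlam D), List.length_append,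
      List.length_singleton, pow_succ, ← mul_assoc]
    exact mul_le_mul ih (by linarith) (by positivity) (sigmaMat_posDef hlam D).det_pos.le

theorem dotProduct_mulVec_le (h : Uncovered lam eps R D) (v : Feat k A d) :
    v ⬝ᵥ (sigmaMat lam D *ᵥ v) ≤ (lam + D.length * R) * (v ⬝ᵥ v) := by
  rw [dotProduct_sigmaMat_mulVec, add_comm lam, add_mul]
  gcongr
  induction h with
  | nil => simp
  | append D x y _ hx _ ih =>
    have hv : 0 ≤ v ⬝ᵥ v := by simpa using dotProduct_self_star_nonneg v
    have hvx : (v ⬝ᵥ x) * (v ⬝ᵥ x) ≤ (v ⬝ᵥ v) * R := by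
      refine le_trans ?_ (mul_le_mul_of_nonneg_left hx hv)
      simpa [dotProduct, pow_two] using Finset.sum_mul_sq_le_sq_mul_sq Finset.univ v x
    simp only [List.map_append, List.sum_append, List.map_cons, List.map_nil, List.sum_singleton,
      List.length_append, List.length_singleton]
    push_cast
    linarith

/-- The elliptical potential bound: each new point multiplies `det Σ` by more than `1 + eps ^ 2`. -/
theorem pow_length_le (h : Uncovered lam eps R D) (hlam : 0 < lam) (heps : 0 ≤ eps) :
    (1 + eps ^ 2) ^ D.length ≤ (1 + D.length * R / lam) ^ (A ^ k * d) := by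
  have hdet := det_le_pow_of_forall_dotProduct_mulVec_le (sigmaMat_posDef hlam D).posSemidef
    h.dotProduct_mulVec_le
  have hfactor : lam + D.length * R = lam * (1 + D.length * R / lam) := by field_simp
  rw [hfactor, mul_pow] at hdet
  simp only [Fintype.card_prod, Fintype.card_pi, Fintype.card_fin, Finset.prod_const,
    Finset.card_univ] at hdet
  exact le_of_mul_le_mul_left ((h.le_det hlam heps).trans hdet) (by positivity)

end Uncovered

end Ridge

/-! ## Values of policies and of action sequences -/

theorem of_ae_dirac {X : Type*} [MeasurableSpace X] {x : X} {Q : X → Prop}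
    (h : ∀ᵐ y ∂Measure.dirac x, Q y) : Q x := by
  by_contra hx
  have hle := Measure.le_dirac_apply (s := {y | ¬ Q y}) (a := x)
  rw [ae_iff.1 h, Set.indicator_of_mem (show x ∈ {y | ¬ Q y} from hx)] at hle
  exact one_ne_zero (le_zero_iff.1 hle)

theorem integral_le_integral_of_nonneg {X : Type*} [MeasurableSpace X] {μ : Measure X}
    {f g : X → ℝ} (hg : Integrable g μ) (hg0 : 0 ≤ ∫ x, g x ∂μ) (hfg : ∀ x, f x ≤ g x) :
    ∫ x, f x ∂μ ≤ ∫ x, g x ∂μ := by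
  by_cases hf : Integrable f μ
  · exact integral_mono hf hg hfg
  · rwa [integral_undef hf]

-- The function need not be measurable: a non-measurable one has integral zero.
theorem integral_dirac_le_of_nonneg {X : Type*} [MeasurableSpace X] {x : X} {f : X → ℝ} {c : ℝ}
    (hc : 0 ≤ c) (hf : f x ≤ c) : ∫ y, f y ∂Measure.dirac x ≤ c := by
  by_cases hfm : AEStronglyMeasurable f (Measure.dirac x)
  · rwa [integral_congr_ae hfm.ae_eq_mk, integral_dirac' _ _ hfm.stronglyMeasurable_mk,
      ← of_ae_dirac hfm.ae_eq_mk]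
  · rwa [integral_non_aestronglyMeasurable hfm]

namespace POMDP

/-- The state reached from `s` at step `h` by executing the actions of a list. -/
def stateFrom {S : Type*} {A : ℕ} (p : ℕ → S → Fin A → S) : ℕ → S → List (Fin A) → S
  | _, s, [] => s
  | h, s, a :: l => stateFrom p (h + 1) (p h s a) l

theorem stateFrom_append {S : Type*} {A : ℕ} (p : ℕ → S → Fin A → S) (h : ℕ) (s : S)
    (l : List (Fin A)) (a : Fin A) :
    stateFrom p h s (l ++ [a]) = p (h + l.length) (stateFrom p h s l) a := by
  induction l generalizing h s with
  | nil => rfl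
  | cons b l ih =>
    simp only [List.cons_append, stateFrom, ih, List.length_cons, Nat.add_right_comm h 1, add_assoc]

variable {S O : Type*} [MeasurableSpace S] [MeasurableSpace O] {A : ℕ}

/-- The sum of the mean rewards collected from `s` at step `h` by the actions of a list, along the
deterministic path of states. -/
noncomputable def pathMean (P : POMDP S O A) (p : ℕ → S → Fin A → S) :
    ℕ → S → List (Fin A) → ℝ
  | _, _, [] => 0
  | h, s, a :: l => P.meanRew h s a + pathMean P p (h + 1) (p h s a) l

theorem pathMean_append (P : POMDP S O A) (p : ℕ → S → Fin A → S) (h : ℕ) (s : S)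
    (l : List (Fin A)) (a : Fin A) :
    P.pathMean p h s (l ++ [a])
      = P.pathMean p h s l + P.meanRew (h + l.length) (stateFrom p h s l) a := by
  induction l generalizing h s with
  | nil => simp [pathMean, stateFrom]
  | cons b l ih =>
    simp only [List.cons_append, pathMean, ih, stateFrom, List.length_cons, add_assoc,
      Nat.add_comm 1]

section Values

variable (P : POMDP S O A) (p : ℕ → S → Fin A → S) (H : ℕ)

theorem integrable_rew (h : ℕ) (a : Fin A) (s : S) : Integrable (fun r : ℝ => r) (P.rew h a s) :=
  Integrable.of_mem_Icc 0 1 measurable_id.aemeasurable (P.rew_mem h a s)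

theorem meanRew_nonneg (h : ℕ) (s : S) (a : Fin A) : 0 ≤ P.meanRew h s a :=
  integral_nonneg_of_ae ((P.rew_mem h a s).mono fun _ hr => hr.1)

theorem integral_rew_add (h : ℕ) (s : S) (a : Fin A) (c : ℝ) :
    ∫ r, (r + c) ∂(P.rew h a s) = P.meanRew h s a + c := by
  rw [integral_add (P.integrable_rew h a s) (integrable_const c)]
  simp [meanRew]

theorem qStep_nonneg (n h : ℕ) (s : S) (a : Fin A) : 0 ≤ P.qStep p n h s a := by
  induction n generalizing h s a with
  | zero => exact le_rfl
  | succ n ih => exact add_nonneg (P.meanRew_nonneg h s a) (Real.iSup_nonneg fun a' => ih _ _ a')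

theorem vStar_nonneg (h : ℕ) (s : S) : 0 ≤ P.vStar p H h s :=
  Real.iSup_nonneg fun _ => P.qStep_nonneg p _ _ _ _

theorem qStar_eq {h : ℕ} (hh : h < H) (s : S) (a : Fin A) :
    P.qStar p H h s a = P.meanRew h s a + P.vStar p H (h + 1) (p h s a) := by
  unfold vStar qStar
  rw [show H - h = H - (h + 1) + 1 by omega]
  rfl

theorem vStar_self (s : S) : P.vStar p H H s = 0 := by
  simp [vStar, qStar, qStep]

theorem qStar_le_vStar (h : ℕ) (s : S) (a : Fin A) : P.qStar p H h s a ≤ P.vStar p H h s :=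
  le_ciSup (Set.finite_range _).bddAbove a

theorem exists_qStar_eq_vStar [NeZero A] (h : ℕ) (s : S) :
    ∃ a, P.qStar p H h s a = P.vStar p H h s :=
  exists_eq_ciSup_of_finite

variable {P p}

theorem valueFrom_le_vStar (hp : P.IsDeterministic p) (π : Policy O A) (n h : ℕ) (hn : h + n = H)
    (l : List (O × Fin A × ℝ)) (s : S) : P.valueFrom π n h l s ≤ P.vStar p H h s := by
  induction n generalizing h l s with
  | zero => exact P.vStar_nonneg p H h s
  | succ n ih =>
    suffices hobs : ∀ o, ∫ r, (r + ∫ s', P.valueFrom π n (h + 1) (l ++ [(o, π l o, r)]) s'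
        ∂(P.trans h (π l o) s)) ∂(P.rew h (π l o) s) ≤ P.vStar p H h s by
      simpa [valueFrom] using integral_le_integral_of_nonneg (μ := P.emit h s)
        (integrable_const (P.vStar p H h s)) (by simpa using P.vStar_nonneg p H h s) hobs
    intro o
    have hnext : ∀ r, ∫ s', P.valueFrom π n (h + 1) (l ++ [(o, π l o, r)]) s'
        ∂(P.trans h (π l o) s) ≤ P.vStar p H (h + 1) (p h s (π l o)) := fun r => by
      rw [hp]
      exact integral_dirac_le_of_nonneg (P.vStar_nonneg p H _ _) (ih (h + 1) (by omega) _ _)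
    refine le_trans ?_ (P.qStar_le_vStar p H h s (π l o))
    rw [P.qStar_eq p H (by omega), ← P.integral_rew_add]
    refine integral_le_integral_of_nonneg ((P.integrable_rew h _ s).add (integrable_const _)) ?_
      fun r => add_le_add_right (hnext r) r
    rw [P.integral_rew_add]
    exact add_nonneg (P.meanRew_nonneg _ _ _) (P.vStar_nonneg p H _ _)

variable (P) in
/-- The expected sum of the rewards collected from `s` at step `h` by the actions of a list. Unlike
`pathMean` it makes no reference to `p`, and so it is measurable in `s`. -/
noncomputable def seqValue : ℕ → List (Fin A) → S → ℝ
  | _, [], _ => 0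
  | h, a :: l, s => P.meanRew h s a + ∫ s', seqValue (h + 1) l s' ∂(P.trans h a s)

theorem stronglyMeasurable_seqValue (h : ℕ) (l : List (Fin A)) :
    StronglyMeasurable (P.seqValue h l) := by
  induction l generalizing h with
  | nil => exact stronglyMeasurable_const
  | cons a l ih =>
    exact (StronglyMeasurable.integral_kernel (κ := P.rew h a) stronglyMeasurable_id).add
      (StronglyMeasurable.integral_kernel (κ := P.trans h a) (ih (h + 1)))

theorem seqValue_eq_pathMean (hp : P.IsDeterministic p) (h : ℕ) (l : List (Fin A)) (s : S) :
    P.seqValue h l s = P.pathMean p h s l := by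
  induction l generalizing h s with
  | nil => rfl
  | cons a l ih =>
    rw [seqValue, pathMean, hp, integral_dirac' _ _ (stronglyMeasurable_seqValue _ _), ih]

theorem valueFrom_openLoop [NeZero A] (l' l : List (Fin A)) (h : ℕ) (hl : l'.drop h = l)
    (hist : List (O × Fin A × ℝ)) (hh : hist.length = h) (s : S) :
    P.valueFrom (openLoop O l') l.length h hist s = P.seqValue h l s := by
  induction l generalizing h hist s with
  | nil => rfl
  | cons a l ih =>
    have hact : ∀ o : O, openLoop O l' hist o = a := fun o => by
      have : l'[h]? = some a := by rw [← List.head?_drop, hl, List.head?_cons]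
      simp [openLoop, hh, this]
    have htail : l'.drop (h + 1) = l := by rw [← List.drop_drop, hl]; rfl
    have hnext : ∀ (x : O × Fin A × ℝ) (s' : S),
        P.valueFrom (openLoop O l') l.length (h + 1) (hist ++ [x]) s' = P.seqValue (h + 1) l s' :=
      fun x s' => ih (h + 1) htail _ (by simp [hh]) s'
    simp only [List.length_cons, valueFrom, seqValue, hact, hnext, integral_rew_add,
      integral_const, probReal_univ, one_smul]

theorem isOptimalActions_of_pathMean_eq [NeZero A] (hp : P.IsDeterministic p)
    {l : List (Fin A)} (hl : l.length = H)
    (hV : P.pathMean p 0 P.init l = P.vStar p H 0 P.init) : P.IsOptimalActions H l := by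
  refine ⟨hl, fun π => (valueFrom_le_vStar H hp π H 0 (Nat.zero_add H) [] P.init).trans_eq ?_⟩
  rw [← hV, ← seqValue_eq_pathMean hp, ← valueFrom_openLoop l l 0 rfl [] rfl, hl]
  rfl

end Values

/-! ## Marginals of the episode law -/

section Marginals

variable {P : POMDP S O A} {p : ℕ → S → Fin A → S}

theorem comp_trans_apply (hp : P.IsDeterministic p) {X : Type*} [MeasurableSpace X]
    (κ : Kernel S X) (h : ℕ) (a : Fin A) (s : S) : (κ ∘ₖ P.trans h a) s = κ (p h s a) := by
  rw [Kernel.comp_apply, hp, Measure.dirac_bind κ.measurable]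

theorem episode_succ_apply (hp : P.IsDeterministic p) (n h : ℕ) (a : Fin (n + 1) → Fin A) (s : S) :
    P.episode (n + 1) h a s
      = (((P.emit h s).prod (P.rew h (a 0) s)).prod
          (P.episode n (h + 1) (fun i => a i.succ) (p h s (a 0)))).map
        (fun x => (Fin.cons x.1 x.2 : Fin (n + 1) → O × ℝ)) := by
  rw [episode, Kernel.map_apply _ (measurable_cons n), Kernel.prod_apply, Kernel.prod_apply,
    comp_trans_apply hp]

theorem window_succ_apply (hp : P.IsDeterministic p) (n h : ℕ) (b : Fin (n + 1) → Fin A) (s : S) :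
    P.window (n + 1) h b s
      = ((P.emit h s).prod (P.window n (h + 1) (fun i => b i.succ) (p h s (b 0)))).map
        (fun x => (Fin.cons x.1 x.2 : Fin (n + 2) → O)) := by
  rw [window, Kernel.map_apply _ (measurable_cons (n + 1)), Kernel.prod_apply,
    comp_trans_apply hp]

theorem map_head_episode (hp : P.IsDeterministic p) (n h : ℕ) (a : Fin (n + 1) → Fin A) (s : S) :
    (P.episode (n + 1) h a s).map (fun x => x 0) = (P.emit h s).prod (P.rew h (a 0) s) := by
  rw [episode_succ_apply hp, Measure.map_map (by fun_prop) (measurable_cons n)]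
  exact Measure.map_fst_prod.trans (by simp)

theorem map_tail_episode (hp : P.IsDeterministic p) (n h : ℕ) (a : Fin (n + 1) → Fin A) (s : S) :
    (P.episode (n + 1) h a s).map (fun x i => x (Fin.succ i))
      = P.episode n (h + 1) (fun i => a i.succ) (p h s (a 0)) := by
  rw [episode_succ_apply hp, Measure.map_map (by fun_prop) (measurable_cons n)]
  exact Measure.map_snd_prod.trans (by simp)

theorem map_drop_episode (hp : P.IsDeterministic p) (l : List (Fin A)) {m n : ℕ}
    (hn : n = l.length + m) (h : ℕ) (a : Fin n → Fin A) (s : S)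
    (ha : ∀ (j : Fin n) (hj : j < l.length), a j = l[j]) :
    (P.episode n h a s).map (fun x (i : Fin m) => x ⟨l.length + i, by omega⟩)
      = P.episode m (h + l.length) (fun i => a ⟨l.length + i, by omega⟩) (stateFrom p h s l) := by
  induction l generalizing n h s with
  | nil =>
    obtain rfl : n = m := by simpa using hn
    simp [stateFrom]
  | cons b l ih =>
    obtain ⟨n, rfl⟩ : ∃ n', n = n' + 1 := ⟨l.length + m, by rw [hn, List.length_cons]; ring⟩
    have hn' : n = l.length + m := by rw [List.length_cons] at hn; omega
    have hb : a 0 = b := ha 0 (by simp)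
    have htail := ih hn' (h + 1) (fun i => a i.succ) (p h s (a 0)) fun j hj =>
      ha j.succ (by simpa using hj)
    rw [← map_tail_episode hp, Measure.map_map (by fun_prop) (by fun_prop), hb] at htail
    simpa only [Function.comp_def, Fin.succ_mk, stateFrom, List.length_cons, add_assoc,
      add_comm, add_left_comm] using htail

theorem map_obs_episode (hp : P.IsDeterministic p) {m n : ℕ} (hmn : m < n) (h : ℕ)
    (a : Fin n → Fin A) (b : Fin m → Fin A) (s : S) (hb : ∀ j : Fin m, a ⟨j, by omega⟩ = b j) :
    (P.episode n h a s).map (fun x (j : Fin (m + 1)) => (x ⟨j, by omega⟩).1)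
      = P.window m h b s := by
  obtain ⟨n, rfl⟩ : ∃ n', n = n' + 1 := ⟨n - 1, by omega⟩
  have hemit : P.emit h s = ((P.emit h s).prod (P.rew h (a 0) s)).map Prod.fst := by
    simp [Measure.map_fst_prod]
  induction m generalizing n h s with
  | zero =>
    rw [window, Kernel.map_apply _ (measurable_pi_lambda _ fun _ => measurable_id'), hemit,
      ← map_head_episode hp, Measure.map_map measurable_fst (by fun_prop),
      Measure.map_map (measurable_pi_lambda _ fun _ => measurable_id') (by fun_prop)]
    congr 1
    funext x j
    rw [Fin.fin_one_eq_zero j]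
    rfl
  | succ m ih =>
    obtain ⟨n, rfl⟩ : ∃ n', n = n' + 1 := ⟨n - 1, by omega⟩
    have hb0 : a 0 = b 0 := hb 0
    have htail := ih (h + 1) (fun i => b i.succ) (p h s (b 0)) n (by omega)
      (fun i => a i.succ) (fun j => hb j.succ) (by simp [Measure.map_fst_prod])
    rw [window_succ_apply hp, ← htail, episode_succ_apply hp, hb0,
      Measure.map_map (by fun_prop) (measurable_cons _), ← hb0]
    nth_rewrite 2 [hemit]
    rw [Measure.map_prod_map _ _ (by fun_prop) (by fun_prop),
      Measure.map_map (measurable_cons _) (by fun_prop)]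
    congr 1
    funext x j
    refine Fin.cases ?_ (fun j => ?_) j <;> rfl

section Plan

variable {H k : ℕ} [NeZero A]

theorem planOf_append_left (l l' : List (Fin A)) (j : Fin (H + k)) (hj : j < l.length) :
    planOf H k (l ++ l') j = l[j] := by
  simp [planOf, List.getElem?_append_left hj, List.getElem?_eq_getElem hj]

theorem planOf_append_ofFn (l : List (Fin A)) {m : ℕ} (b : Fin m → Fin A) (j : Fin m)
    (hj : l.length + j < H + k) :
    planOf H k (l ++ List.ofFn b) ⟨l.length + j, hj⟩ = b j := by
  simp [planOf]

theorem map_rewardAt_episode (hp : P.IsDeterministic p) (h : Fin H) {l : List (Fin A)}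
    (hl : l.length = h) (a : Fin A) :
    (P.episode (H + k) 0 (planOf H k (l ++ [a])) P.init).map (rewardAt h)
      = P.rew h a (stateFrom p 0 P.init l) := by
  obtain ⟨h, hH⟩ := h
  subst hl
  obtain ⟨m, hm⟩ : ∃ m, H + k = l.length + (m + 1) := ⟨H + k - l.length - 1, by omega⟩
  have hdrop := congrArg (Measure.map fun x => (x 0).2) (map_drop_episode hp l hm 0
    (planOf H k (l ++ [a])) P.init fun j hj => planOf_append_left l [a] j hj)
  have hplan : planOf H k (l ++ [a]) ⟨l.length, by omega⟩ = a := by simp [planOf]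
  have hhead (a : Fin (m + 1) → Fin A) (s : S) :
      (P.episode (m + 1) l.length a s).map (fun x => (x 0).2) = P.rew l.length (a 0) s := by
    rw [← Function.comp_def Prod.snd, ← Measure.map_map measurable_snd (measurable_pi_apply 0),
      map_head_episode hp, Measure.map_snd_prod, measure_univ, one_smul]
  rw [Measure.map_map (by fun_prop) (by fun_prop), Nat.zero_add, hhead] at hdrop
  unfold rewardAt
  simpa [Function.comp_def, hplan] using hdrop

theorem map_obsWindow_episode (hp : P.IsDeterministic p) (h : Fin H) {l : List (Fin A)}
    (hl : l.length = h) (b : Fin k → Fin A) :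
    (P.episode (H + k) 0 (planOf H k (l ++ List.ofFn b)) P.init).map (obsWindow h)
      = P.window k h b (stateFrom p 0 P.init l) := by
  obtain ⟨h, hH⟩ := h
  subst hl
  have hdrop := map_drop_episode hp l (m := H + k - l.length) (by omega) 0
    (planOf H k (l ++ List.ofFn b)) P.init fun j hj => planOf_append_left l _ j hj
  have hobs := map_obs_episode hp (show k < H + k - l.length by omega) (0 + l.length)
    (fun i => planOf H k (l ++ List.ofFn b) ⟨l.length + i, by omega⟩) b
    (stateFrom p 0 P.init l) fun j => planOf_append_ofFn l b j (by omega)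
  rw [← hdrop, Measure.map_map (by fun_prop) (by fun_prop)] at hobs
  unfold obsWindow
  simpa [Function.comp_def] using hobs

end Plan

end Marginals

end POMDP

/-! ## Hoeffding bounds -/

section Hoeffding

variable {Ω : Type*} [MeasurableSpace Ω] {μ : Measure Ω} [IsProbabilityMeasure μ]

theorem measureReal_lt_abs_le_of_hasSubgaussianMGF {X : Ω → ℝ} {c : NNReal}
    (hX : HasSubgaussianMGF X c μ) {ε : ℝ} (hε : 0 ≤ ε) :
    μ.real {ω | ε < |X ω|} ≤ 2 * Real.exp (-ε ^ 2 / (2 * c)) := by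
  have hsub : {ω | ε < |X ω|} ⊆ {ω | ε ≤ X ω} ∪ {ω | ε ≤ (-X) ω} := by
    rintro ω (hω : ε < |X ω|)
    rcases lt_abs.1 hω with hpos | hneg
    exacts [Or.inl hpos.le, Or.inr hneg.le]
  refine (measureReal_mono hsub).trans ((measureReal_union_le _ _).trans ?_)
  rw [two_mul]
  exact add_le_add (hX.measure_ge_le hε) (hX.neg.measure_ge_le hε)

theorem measureReal_lt_abs_sum_sub_integral_le {ι : Type*} [Fintype ι] {X : ι → Ω → ℝ}
    (hindep : iIndepFun X μ) (hX : ∀ i, AEMeasurable (X i) μ) {α β : ℝ}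
    (hmem : ∀ i, ∀ᵐ ω ∂μ, X i ω ∈ Set.Icc α β) {ε : ℝ} (hε : 0 ≤ ε) :
    μ.real {ω | ε < |∑ i, (X i ω - ∫ ω', X i ω' ∂μ)|}
      ≤ 2 * Real.exp (-(2 * ε ^ 2) / (Fintype.card ι * (β - α) ^ 2)) := by
  have hsum := HasSubgaussianMGF.sum_of_iIndepFun (s := Finset.univ)
    (hindep.comp (fun i x => x - ∫ ω', X i ω' ∂μ) fun _ => by fun_prop)
    fun i _ => hasSubgaussianMGF_of_mem_Icc (hX i) (hmem i)
  refine (measureReal_lt_abs_le_of_hasSubgaussianMGF hsum hε).trans_eq ?_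
  have hvar : (2 * ((∑ _i : ι, (‖β - α‖₊ / 2) ^ 2 : NNReal) : ℝ))
      = Fintype.card ι * (β - α) ^ 2 / 2 := by
    simp only [Finset.sum_const, Finset.card_univ, nsmul_eq_mul, NNReal.coe_mul,
      NNReal.coe_natCast, NNReal.coe_pow, NNReal.coe_div, coe_nnnorm, NNReal.coe_ofNat,
      Real.norm_eq_abs, div_pow, sq_abs]
    ring
  rw [hvar, div_div_eq_mul_div]
  congr 3
  ring

end Hoeffding

theorem measureReal_le_card_mul_of_subset_iUnion {Ω : Type*} [MeasurableSpace Ω] {μ : Measure Ω}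
    [IsFiniteMeasure μ] {ι : Type*} [Fintype ι] {s : Set Ω} {t : ι → Set Ω} (hs : s ⊆ ⋃ i, t i)
    {b : ℝ} (ht : ∀ i, μ.real (t i) ≤ b) : μ.real s ≤ Fintype.card ι * b := by
  refine (measureReal_mono hs).trans ((measureReal_iUnion_fintype_le t).trans
    ((Finset.sum_le_sum fun i _ => ht i).trans_eq ?_))
  rw [Finset.sum_const, Finset.card_univ, nsmul_eq_mul]

section Tape

variable {S O : Type*} [MeasurableSpace S] [MeasurableSpace O] {H k A : ℕ}

theorem map_tapeLaw_eval (P : POMDP S O A) (i : ℕ × Plan H k A) :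
    (tapeLaw P H k).map (fun ω => ω i) = P.episode (H + k) 0 i.2 P.init :=
  Measure.infinitePi_map_eval _ _

theorem iIndepFun_tapeLaw (P : POMDP S O A) :
    iIndepFun (fun (i : ℕ × Plan H k A) (ω : Tape H k A O) => ω i) (tapeLaw P H k) :=
  iIndepFun_infinitePi (X := fun _ x => x) (by fun_prop)

/-- `f` has values in `[α, β]` and mean `m` over the outcomes of an episode with the plan `a`. -/
structure HasEpisodeMean (P : POMDP S O A) (a : Plan H k A) (f : Outcome H k O → ℝ)
    (α β m : ℝ) : Prop where
  measurable : Measurable f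
  mem_Icc : ∀ᵐ x ∂(P.episode (H + k) 0 a P.init), f x ∈ Set.Icc α β
  integral_eq : ∫ x, f x ∂(P.episode (H + k) 0 a P.init) = m

theorem tapeLaw_lt_abs_sum_sub_le (P : POMDP S O A) {ι : Type*} [Fintype ι]
    {idx : ι → ℕ × Plan H k A} (hidx : Function.Injective idx) {f : ι → Outcome H k O → ℝ}
    {α β : ℝ} {m : ι → ℝ} (hf : ∀ i, HasEpisodeMean P (idx i).2 (f i) α β (m i)) {ε : ℝ}
    (hε : 0 ≤ ε) :
    (tapeLaw P H k).real {ω | ε < |∑ i, (f i (ω (idx i)) - m i)|}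
      ≤ 2 * Real.exp (-(2 * ε ^ 2) / (Fintype.card ι * (β - α) ^ 2)) := by
  have hmean : ∀ i, ∫ ω, f i (ω (idx i)) ∂(tapeLaw P H k) = m i := fun i => by
    rw [← (hf i).integral_eq, ← map_tapeLaw_eval P, integral_map
      (measurable_pi_apply _).aemeasurable (hf i).measurable.aestronglyMeasurable]
  have hmem : ∀ i, ∀ᵐ ω ∂(tapeLaw P H k), f i (ω (idx i)) ∈ Set.Icc α β := fun i => by
    have := (hf i).mem_Icc
    rw [← map_tapeLaw_eval P] at this
    exact ae_of_ae_map (measurable_pi_apply _).aemeasurable this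
  simpa only [Function.comp_apply, hmean] using measureReal_lt_abs_sum_sub_integral_le
    (((iIndepFun_tapeLaw P).precomp hidx).comp f fun i => (hf i).measurable)
    (fun i => ((hf i).measurable.comp (measurable_pi_apply _)).aemeasurable) hmem hε

theorem tapeLaw_lt_abs_sum_mean_sub_le (P : POMDP S O A) {ι : Type*} [Fintype ι] {M : ℕ}
    (hM : 0 < M) {n : ι → ℕ} (hn : ∀ i j, i ≠ j → n i + M ≤ n j ∨ n j + M ≤ n i)
    {a : ι → Plan H k A} {f : ι → Outcome H k O → ℝ} {α β : ℝ} {m : ι → ℝ}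
    (hf : ∀ i, HasEpisodeMean P (a i) (f i) α β (m i)) {e : ℝ} (he : 0 ≤ e) :
    (tapeLaw P H k).real {ω | e < |∑ i, ((∑ j : Fin M, f i (ω (n i + j, a i))) / M - m i)|}
      ≤ 2 * Real.exp (-(2 * e ^ 2 * M) / (Fintype.card ι * (β - α) ^ 2)) := by
  have hM' : (0 : ℝ) < M := Nat.cast_pos.2 hM
  have hidx : Function.Injective fun i : ι × Fin M => (n i.1 + i.2, a i.1) := by
    intro ⟨i, j⟩ ⟨i', j'⟩ hij
    have hfst : n i + j = n i' + j' := congrArg Prod.fst hij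
    obtain rfl : i = i' := by
      by_contra hne
      have := hn i i' hne
      omega
    exact Prod.ext rfl (Fin.ext (Nat.add_left_cancel hfst))
  have hscale : ∀ ω : Tape H k A O,
      (∑ i, ((∑ j : Fin M, f i (ω (n i + j, a i))) / M - m i)) * M
        = ∑ i : ι × Fin M, (f i.1 (ω (n i.1 + i.2, a i.1)) - m i.1) := fun ω => by
    simp only [Fintype.sum_prod_type, Finset.sum_mul]
    refine Finset.sum_congr rfl fun i _ => ?_
    rw [sub_mul, div_mul_cancel₀ _ hM'.ne', Finset.sum_sub_distrib, Finset.sum_const,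
      Finset.card_univ, Fintype.card_fin, nsmul_eq_mul, mul_comm (m i)]
  have htail := tapeLaw_lt_abs_sum_sub_le P hidx (fun i => hf i.1)
    (mul_nonneg he hM'.le)
  simp only [← hscale, abs_mul, abs_of_pos hM', mul_lt_mul_iff_left₀ hM'] at htail
  refine htail.trans_eq ?_
  rw [Fintype.card_prod, Fintype.card_fin, Nat.cast_mul,
    ← mul_div_mul_right (-(2 * e ^ 2 * M)) _ hM'.ne']
  ring_nf

end Tape

/-! ## Accuracy of the estimates -/

section Estimates

variable {O : Type*} {H k A d : ℕ}

/-- The vector with the block `θ` at the action sequence `b` and zeros elsewhere: the linear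
functional of the stacked features that only reads the window observed under `b`. -/
noncomputable def blockVec (b : Fin k → Fin A) (θ : EuclideanSpace ℝ (Fin d)) : Feat k A d :=
  fun bj => if bj.1 = b then θ bj.2 else 0

theorem blockVec_dotProduct (b : Fin k → Fin A) (θ : EuclideanSpace ℝ (Fin d)) (x : Feat k A d) :
    blockVec b θ ⬝ᵥ x = ∑ j, θ j * x (b, j) := by
  simp [blockVec, dotProduct, Fintype.sum_prod_type, ite_mul]

theorem blockVec_dotProduct_self (b : Fin k → Fin A) (θ : EuclideanSpace ℝ (Fin d)) :
    blockVec b θ ⬝ᵥ blockVec b θ = ‖θ‖ ^ 2 := by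
  rw [blockVec_dotProduct, EuclideanSpace.norm_sq_eq]
  simp [blockVec, pow_two]

variable [NeZero A] (I : AlgInput k A d O) (ω : Tape H k A O)

theorem blockVec_dotProduct_featEst (b : Fin k → Fin A) (θ : EuclideanSpace ℝ (Fin d))
    (h : Fin H) (l : List (Fin A)) (n : ℕ) :
    blockVec b θ ⬝ᵥ featEst I ω h l n
      = (∑ i : Fin I.M, inner ℝ θ (I.ψ (obsWindow h
          (ω (n + I.M * (finFunctionFinEquiv b : Fin (A ^ k)) + i,
            planOf H k (l ++ List.ofFn b)))))) / I.M := by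
  rw [blockVec_dotProduct]
  simp only [featEst, ← mul_div_assoc, ← Finset.sum_div, Finset.mul_sum]
  rw [Finset.sum_comm]
  simp only [PiLp.inner_apply, RCLike.inner_apply, conj_trivial, mul_comm]

theorem norm_sum_div_card_le_one {E : Type*} [SeminormedAddCommGroup E] [NormedSpace ℝ E] {M : ℕ}
    {v : Fin M → E} (hv : ∀ i, ‖v i‖ ≤ 1) : ‖(M : ℝ)⁻¹ • ∑ i, v i‖ ≤ 1 := by
  rw [norm_smul, norm_inv, Real.norm_natCast]
  refine inv_mul_le_one_of_le₀ ?_ M.cast_nonneg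
  simpa using norm_sum_le_of_le Finset.univ fun i _ => hv i

theorem featEst_dotProduct_self_le (hψ : ∀ o, ‖I.ψ o‖ ≤ 1) (h : Fin H) (l : List (Fin A))
    (n : ℕ) : featEst I ω h l n ⬝ᵥ featEst I ω h l n ≤ (A : ℝ) ^ k := by
  have hblock : ∀ b : Fin k → Fin A,
      ∑ j, featEst I ω h l n (b, j) * featEst I ω h l n (b, j) ≤ 1 := fun b => by
    have hmean := norm_sum_div_card_le_one fun i : Fin I.M => hψ (obsWindow h
      (ω (n + I.M * (finFunctionFinEquiv b : Fin (A ^ k)) + i, planOf H k (l ++ List.ofFn b))))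
    rw [← sq_le_one_iff₀ (norm_nonneg _), EuclideanSpace.norm_sq_eq] at hmean
    simpa [featEst, div_eq_inv_mul, ← pow_two, mul_pow] using hmean
  rw [dotProduct, Fintype.sum_prod_type]
  exact (Finset.sum_le_sum fun b _ => hblock b).trans_eq (by simp)

end Estimates

section Accuracy

variable {S O : Type*} [MeasurableSpace S] [MeasurableSpace O] {H k A d : ℕ} [NeZero A]
  {P : POMDP S O A} {p : ℕ → S → Fin A → S}

theorem measurable_obsWindow (h : Fin H) :
    Measurable (obsWindow h : Outcome H k O → Fin (k + 1) → O) := by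
  unfold obsWindow
  fun_prop

theorem measurable_rewardAt (h : Fin H) : Measurable (rewardAt h : Outcome H k O → ℝ) := by
  unfold rewardAt
  fun_prop

theorem hasEpisodeMean_inner_obsWindow (hp : P.IsDeterministic p)
    {ψ : (Fin (k + 1) → O) → EuclideanSpace ℝ (Fin d)} (hψm : Measurable ψ)
    (hψ : ∀ o, ‖ψ o‖ ≤ 1) {θ : EuclideanSpace ℝ (Fin d)} {Θ : ℝ} (hθ : ‖θ‖ ≤ Θ) (h : Fin H)
    {l : List (Fin A)} (hl : l.length = h) (b : Fin k → Fin A) :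
    HasEpisodeMean P (planOf H k (l ++ List.ofFn b)) (fun x => inner ℝ θ (ψ (obsWindow h x)))
      (-Θ) Θ (inner ℝ θ (∫ o, ψ o ∂(P.window k h b (POMDP.stateFrom p 0 P.init l)))) where
  measurable := measurable_const.inner (hψm.comp (measurable_obsWindow h))
  mem_Icc := ae_of_all _ fun x => abs_le.1 <|
    (abs_real_inner_le_norm _ _).trans <| (mul_le_of_le_one_right (norm_nonneg θ) (hψ _)).trans hθ
  integral_eq := by
    rw [← integral_inner (Integrable.of_bound hψm.aestronglyMeasurable 1 (ae_of_all _ hψ)),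
      ← POMDP.map_obsWindow_episode hp h hl b,
      integral_map (measurable_obsWindow h).aemeasurable (by fun_prop)]

theorem hasEpisodeMean_rewardAt (hp : P.IsDeterministic p) (h : Fin H) {l : List (Fin A)}
    (hl : l.length = h) (a : Fin A) :
    HasEpisodeMean P (planOf H k (l ++ [a])) (rewardAt h) 0 1
      (P.meanRew h (POMDP.stateFrom p 0 P.init l) a) where
  measurable := measurable_rewardAt h
  mem_Icc := by
    have := P.rew_mem h a (POMDP.stateFrom p 0 P.init l)
    rw [← POMDP.map_rewardAt_episode (k := k) hp h hl] at this
    exact ae_of_ae_map (measurable_rewardAt h).aemeasurable this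
  integral_eq := by
    rw [POMDP.meanRew, ← POMDP.map_rewardAt_episode (k := k) hp h hl]
    exact (integral_map (f := fun r : ℝ => r) (measurable_rewardAt h).aemeasurable
      (by fun_prop)).symm

variable {I : AlgInput k A d O}

theorem tapeLaw_lt_abs_featEst_sub_le (hp : P.IsDeterministic p) (hM : 0 < I.M)
    (hψm : Measurable I.ψ) (hψ : ∀ o, ‖I.ψ o‖ ≤ 1) (b : Fin k → Fin A)
    {θ : EuclideanSpace ℝ (Fin d)} {Θ : ℝ} (hθ : ‖θ‖ ≤ Θ) (h : Fin H) {l : List (Fin A)}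
    (hl : l.length = h) (n : ℕ) {e : ℝ} (he : 0 ≤ e) :
    (tapeLaw P H k).real {ω | e < |blockVec b θ ⬝ᵥ featEst I ω h l n
        - inner ℝ θ (∫ o, I.ψ o ∂(P.window k h b (POMDP.stateFrom p 0 P.init l)))|}
      ≤ 2 * Real.exp (-(e ^ 2 * I.M) / (2 * Θ ^ 2)) := by
  have htail := tapeLaw_lt_abs_sum_mean_sub_le P (ι := Unit) hM
    (n := fun _ => n + I.M * (finFunctionFinEquiv b : Fin (A ^ k)))
    (fun _ _ hne => (hne rfl).elim)
    (fun _ => hasEpisodeMean_inner_obsWindow hp hψm hψ hθ h hl b) he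
  simp only [Fintype.sum_unique, ← blockVec_dotProduct_featEst] at htail
  refine htail.trans_eq ?_
  rw [Fintype.card_unit, show ((1 : ℕ) : ℝ) * (Θ - -Θ) ^ 2 = 2 * (2 * Θ ^ 2) by push_cast; ring,
    ← mul_div_mul_left (-(e ^ 2 * I.M)) (2 * Θ ^ 2) two_ne_zero]
  ring_nf

variable (P p I) in
/-- The sum over the steps `t ≥ h` of the deviations of the reward estimates along the action
sequence `l` of length `H`, where step `t` uses the episodes from number `idx t` on. -/
noncomputable def pathDev (ω : Tape H k A O) (l : List (Fin A)) (idx : Fin H → ℕ) (h : ℕ) : ℝ :=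
  ∑ t ∈ ({t | h ≤ (t : ℕ)} : Finset (Fin H)), (rewEst I ω t (l.take t ++ [l.getD t 0]) (idx t)
    - P.meanRew t (POMDP.stateFrom p 0 P.init (l.take t)) (l.getD t 0))

theorem pathDev_congr {ω : Tape H k A O} {l : List (Fin A)} {idx idx' : Fin H → ℕ} {h : ℕ}
    (hidx : ∀ t : Fin H, h ≤ t → idx t = idx' t) :
    pathDev P p I ω l idx h = pathDev P p I ω l idx' h :=
  Finset.sum_congr rfl fun t ht => by rw [hidx t (by simpa using ht)]

/-- From step `h` on, the blocks of `M` episodes that start at the numbers `idx t` follow each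
other. -/
def Spaced (M : ℕ) (idx : Fin H → ℕ) (h : ℕ) : Prop :=
  ∀ t t' : Fin H, h ≤ t → t < t' → idx t + M ≤ idx t'

theorem tapeLaw_lt_abs_pathDev_le (hp : P.IsDeterministic p) (hM : 0 < I.M) {l : List (Fin A)}
    (hl : l.length = H) (idx : Fin H → ℕ) (h : Fin H) (hidx : Spaced I.M idx h) {e : ℝ}
    (he : 0 ≤ e) :
    (tapeLaw P H k).real {ω | e < |pathDev P p I ω l idx h|}
      ≤ 2 * Real.exp (-(2 * e ^ 2 * I.M) / H) := by
  set T : Finset (Fin H) := {t | (h : ℕ) ≤ t} with hT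
  have hspaced : ∀ t t' : T, t ≠ t' → idx t + I.M ≤ idx t' ∨ idx t' + I.M ≤ idx t := by
    rintro ⟨t, ht⟩ ⟨t', ht'⟩ hne
    simp only [hT, Finset.mem_filter_univ] at ht ht'
    exact (lt_or_gt_of_ne fun heq => hne (Subtype.ext heq)).imp (hidx t t' ht) (hidx t' t ht')
  have htail := tapeLaw_lt_abs_sum_mean_sub_le P hM hspaced
    (fun t => hasEpisodeMean_rewardAt (k := k) hp t.1 (l := l.take t) (by simp [hl])
      (l.getD t 0)) he
  have hsum : ∀ ω : Tape H k A O, pathDev P p I ω l idx h = ∑ t : T, _ := fun ω =>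
    (Finset.sum_coe_sort T _).symm
  simp only [hsum]
  refine htail.trans ?_
  have hcard : (Fintype.card T : ℝ) ≤ H := by
    rw [Fintype.card_coe]
    exact_mod_cast (Finset.card_le_univ T).trans_eq (Fintype.card_fin H)
  have hcard0 : (0 : ℝ) < Fintype.card T := by
    rw [Fintype.card_coe]
    exact_mod_cast Finset.card_pos.2 ⟨h, by simp [hT]⟩
  rw [sub_zero, one_pow, mul_one, neg_div, neg_div]
  gcongr

variable (P p I) in
/-- All the estimates that use the first `N` episodes are accurate up to `e`: the functional `θ h a`
of the feature estimates gives the optimal value of `a`, and reward estimates along an action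
sequence have a small total deviation. -/
structure GoodTape (θ : Fin H → Fin A → Feat k A d) (e : ℝ) (N : ℕ) (ω : Tape H k A O) : Prop where
  feat : ∀ (h : Fin H) (a : Fin A) (l : List (Fin A)) (n : ℕ), l.length = h → n < N →
    |θ h a ⬝ᵥ featEst I ω h l n - P.qStar p H h (POMDP.stateFrom p 0 P.init l) a| ≤ e
  rew : ∀ (h : Fin H) (l : List (Fin A)) (idx : Fin H → ℕ), l.length = H → Spaced I.M idx h →
    (∀ t, h ≤ t → idx t < N) → |pathDev P p I ω l idx h| ≤ e

theorem tapeLaw_exists_lt_abs_featEst_sub_le (hp : P.IsDeterministic p) (hM : 0 < I.M)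
    (hψm : Measurable I.ψ) (hψ : ∀ o, ‖I.ψ o‖ ≤ 1) (b : Fin H → Fin k → Fin A)
    {θ : Fin H → Fin A → EuclideanSpace ℝ (Fin d)} {Θ : ℝ} (hθ : ∀ h a, ‖θ h a‖ ≤ Θ) (N : ℕ)
    {e : ℝ} (he : 0 ≤ e) :
    (tapeLaw P H k).real {ω | ∃ (h : Fin H) (a : Fin A) (l : List (Fin A)) (n : ℕ),
        l.length = h ∧ n < N ∧ e < |blockVec (b h) (θ h a) ⬝ᵥ featEst I ω h l n
          - inner ℝ (θ h a) (∫ o, I.ψ o ∂(P.window k h (b h) (POMDP.stateFrom p 0 P.init l)))|}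
      ≤ H * A * A ^ H * N * (2 * Real.exp (-(e ^ 2 * I.M) / (2 * Θ ^ 2))) := by
  refine (measureReal_le_card_mul_of_subset_iUnion
    (ι := Fin H × Fin A × List.Vector (Fin A) H × Fin N) ?_ fun i =>
      tapeLaw_lt_abs_featEst_sub_le hp hM hψm hψ (b i.1) (hθ i.1 i.2.1) i.1
        (l := i.2.2.1.toList.take i.1) (by simp) i.2.2.2 he).trans_eq ?_
  · rintro ω ⟨h, a, l, n, hl, hn, hlt⟩
    have htake : (l ++ List.replicate (H - h) 0).take h = l := by simp [← hl]
    refine Set.mem_iUnion.2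
      ⟨(h, a, ⟨l ++ List.replicate (H - h) 0, by simp [hl]⟩, ⟨n, hn⟩), ?_⟩
    simpa [htake] using hlt
  · simp [card_vector, mul_assoc]

theorem tapeLaw_exists_lt_abs_pathDev_le (hp : P.IsDeterministic p) (hM : 0 < I.M) (N : ℕ) {e : ℝ}
    (he : 0 ≤ e) :
    (tapeLaw P H k).real {ω | ∃ (h : Fin H) (l : List (Fin A)) (idx : Fin H → ℕ), l.length = H ∧
        Spaced I.M idx h ∧ (∀ t, h ≤ t → idx t < N) ∧ e < |pathDev P p I ω l idx h|}
      ≤ H * A ^ H * N ^ H * (2 * Real.exp (-(2 * e ^ 2 * I.M) / H)) := by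
  refine (measureReal_le_card_mul_of_subset_iUnion
    (ι := Fin H × List.Vector (Fin A) H × (Fin H → Fin N))
    (t := fun i => {ω | Spaced I.M (fun t => i.2.2 t) i.1 ∧
      e < |pathDev P p I ω i.2.1.toList (fun t => i.2.2 t) i.1|})
    (b := 2 * Real.exp (-(2 * e ^ 2 * I.M) / H)) ?_ fun i => ?_).trans_eq ?_
  · rintro ω ⟨h, l, idx, hl, hidx, hN, hlt⟩
    have : NeZero N := ⟨(Nat.zero_le _ |>.trans_lt (hN h le_rfl)).ne'⟩
    have hmod : ∀ t, h ≤ t → idx t % N = idx t := fun t ht => Nat.mod_eq_of_lt (hN t ht)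
    refine Set.mem_iUnion.2 ⟨(h, ⟨l, hl⟩, fun t => Fin.ofNat N (idx t)), fun t t' ht htt' => ?_, ?_⟩
    · simpa only [Fin.val_ofNat, hmod t ht, hmod t' (le_trans ht htt'.le)] using hidx t t' ht htt'
    · exact hlt.trans_eq (congrArg abs (pathDev_congr fun t ht => (hmod t ht).symm))
  · by_cases hidx : Spaced I.M (fun t => (i.2.2 t : ℕ)) i.1
    · simpa only [hidx, true_and] using
        tapeLaw_lt_abs_pathDev_le hp hM (List.Vector.toList_length _) _ i.1 hidx he
    · simp only [hidx, false_and, Set.ofPred_false, measureReal_empty]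
      positivity
  · simp [card_vector, mul_assoc]

theorem tapeLaw_not_goodTape_le (hp : P.IsDeterministic p) (hM : 0 < I.M)
    (hψm : Measurable I.ψ) (hψ : ∀ o, ‖I.ψ o‖ ≤ 1) {b : Fin H → Fin k → Fin A}
    {θ : Fin H → Fin A → EuclideanSpace ℝ (Fin d)} {Θ : ℝ} (hθ : ∀ h a, ‖θ h a‖ ≤ Θ)
    (hq : ∀ (h : Fin H) a s,
      P.qStar p H h s a = inner ℝ (θ h a) (∫ o, I.ψ o ∂(P.window k h (b h) s)))
    (N : ℕ) {e : ℝ} (he : 0 ≤ e) :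
    (tapeLaw P H k).real {ω | ¬ GoodTape P p I (fun h a => blockVec (b h) (θ h a)) e N ω}
      ≤ H * A * A ^ H * N * (2 * Real.exp (-(e ^ 2 * I.M) / (2 * Θ ^ 2)))
        + H * A ^ H * N ^ H * (2 * Real.exp (-(2 * e ^ 2 * I.M) / H)) := by
  refine (measureReal_mono fun ω hω => ?_).trans ((measureReal_union_le _ _).trans (add_le_add
    (tapeLaw_exists_lt_abs_featEst_sub_le hp hM hψm hψ b hθ N he)
    (tapeLaw_exists_lt_abs_pathDev_le hp hM N he)))
  by_contra hgood
  rw [Set.mem_union, not_or] at hgood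
  refine hω ⟨fun h a l n hl hn => ?_, fun h l idx hl hidx hN => ?_⟩
  · rw [hq]
    exact not_lt.1 fun hlt => hgood.1 ⟨h, a, l, n, hl, hn, hlt⟩
  · exact not_lt.1 fun hlt => hgood.2 ⟨h, l, idx, hl, hidx, hN, hlt⟩

end Accuracy

/-! ## Runs of the algorithm on a good tape -/

section Sandwiched

variable {S O : Type*} [MeasurableSpace S] [MeasurableSpace O] {H k A d : ℕ} [NeZero A]
  {P : POMDP S O A} {p : ℕ → S → Fin A → S} {I : AlgInput k A d O} {ω : Tape H k A O}
  {l : List (Fin A)} {h n₀ n₁ n₀' n₁' : ℕ} {x : ℝ}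

variable (P p I ω) in
/-- `x` is the total deviation, from step `h` on, of reward estimates along an action sequence that
extends `l`, based on successive blocks of the episodes `n₀, …, n₁ - 1`. -/
def IsPathDev (l : List (Fin A)) (h n₀ n₁ : ℕ) (x : ℝ) : Prop :=
  ∃ (l' : List (Fin A)) (idx : Fin H → ℕ), l'.length = H ∧ l <+: l' ∧ Spaced I.M idx h ∧
    (∀ t : Fin H, h ≤ t → n₀ ≤ idx t ∧ idx t + I.M ≤ n₁) ∧ pathDev P p I ω l' idx h = x

variable (P p I ω) in
/-- `x` lies between two deviations of reward estimates along action sequences that extend `l`. A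
computed value satisfies no more than this, because the maximizing actions of the computed and of
the true values need not agree. -/
def Sandwiched (l : List (Fin A)) (h n₀ n₁ : ℕ) (x : ℝ) : Prop :=
  (∃ y, IsPathDev P p I ω l h n₀ n₁ y ∧ x ≤ y) ∧ ∃ y, IsPathDev P p I ω l h n₀ n₁ y ∧ y ≤ x

theorem IsPathDev.mono (hx : IsPathDev P p I ω l h n₀ n₁ x) (h₀ : n₀' ≤ n₀) (h₁ : n₁ ≤ n₁') :
    IsPathDev P p I ω l h n₀' n₁' x := by
  obtain ⟨l', idx, hl', hpre, hsp, hbd, hx⟩ := hx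
  exact ⟨l', idx, hl', hpre, hsp, fun t ht =>
    ⟨h₀.trans (hbd t ht).1, (hbd t ht).2.trans h₁⟩, hx⟩

theorem isPathDev_last (hl : l.length = H) : IsPathDev P p I ω l H n₀ n₁ 0 :=
  ⟨l, 0, hl, l.prefix_refl, fun t _ ht => absurd t.2 ht.not_gt, fun t ht => absurd t.2 ht.not_gt,
    Finset.sum_eq_zero fun t ht => absurd t.2 (Finset.mem_filter_univ t |>.1 ht).not_gt⟩

theorem pathDev_eq_add (l : List (Fin A)) (idx : Fin H → ℕ) (h : Fin H) :
    pathDev P p I ω l idx h = rewEst I ω h (l.take h ++ [l.getD h 0]) (idx h)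
      - P.meanRew h (POMDP.stateFrom p 0 P.init (l.take h)) (l.getD h 0)
      + pathDev P p I ω l idx (h + 1) := by
  have hset : ({t | (h : ℕ) ≤ t} : Finset (Fin H))
      = insert h ({t | (h : ℕ) + 1 ≤ t} : Finset (Fin H)) := by
    ext t
    simp only [Finset.mem_filter_univ, Finset.mem_insert, Fin.ext_iff]
    omega
  rw [pathDev, hset, Finset.sum_insert (by simp), pathDev]

theorem IsPathDev.cons {h : Fin H} (hl : l.length = h) {a : Fin A} {n : ℕ}
    (hn : n + I.M ≤ n₀) (hn' : n₀ ≤ n₁) (hx : IsPathDev P p I ω (l ++ [a]) (h + 1) n₀ n₁ x) :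
    IsPathDev P p I ω l h n n₁ (rewEst I ω h (l ++ [a]) n
      - P.meanRew h (POMDP.stateFrom p 0 P.init l) a + x) := by
  obtain ⟨l', idx, hl', hpre, hsp, hbd, rfl⟩ := hx
  have htake : l'.take h = l := by
    rw [← hl, ← List.prefix_iff_eq_take.1 ((List.prefix_append l [a]).trans hpre)]
  have hget : l'.getD h 0 = a := by
    obtain ⟨r, rfl⟩ := hpre
    simp [← hl]
  have hidx : ∀ t : Fin H, (h : ℕ) + 1 ≤ t → Function.update idx h n t = idx t := fun t ht =>
    Function.update_of_ne (Fin.ne_of_gt ht) _ _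
  refine ⟨l', Function.update idx h n, hl', (List.prefix_append l [a]).trans hpre,
    fun t t' ht htt' => ?_, fun t ht => ?_, ?_⟩
  · rw [hidx t' (by omega)]
    rcases ht.eq_or_lt with heq | hlt
    · obtain rfl := Fin.ext heq
      rw [Function.update_self]
      exact hn.trans (hbd t' htt').1
    · rw [hidx t hlt]
      exact hsp t t' hlt htt'
  · rcases ht.eq_or_lt with heq | hlt
    · obtain rfl := Fin.ext heq
      rw [Function.update_self]
      exact ⟨le_rfl, hn.trans hn'⟩
    · rw [hidx t hlt]
      exact ⟨(Nat.le_add_right _ _).trans (hn.trans (hbd t hlt).1), (hbd t hlt).2⟩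
  · rw [pathDev_eq_add, htake, hget, Function.update_self, pathDev_congr hidx]

theorem Sandwiched.mono (hx : Sandwiched P p I ω l h n₀ n₁ x) (h₀ : n₀' ≤ n₀) (h₁ : n₁ ≤ n₁') :
    Sandwiched P p I ω l h n₀' n₁' x := by
  obtain ⟨⟨y, hy, hxy⟩, z, hz, hzx⟩ := hx
  exact ⟨⟨y, hy.mono h₀ h₁, hxy⟩, z, hz.mono h₀ h₁, hzx⟩

theorem sandwiched_last (hl : l.length = H) : Sandwiched P p I ω l H n₀ n₁ 0 :=
  ⟨⟨0, isPathDev_last hl, le_rfl⟩, 0, isPathDev_last hl, le_rfl⟩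

theorem Sandwiched.cons {h : Fin H} (hl : l.length = h) {a : Fin A} {n : ℕ} {v : ℝ}
    (hn : n + I.M ≤ n₀) (hn' : n₀ ≤ n₁)
    (hv : Sandwiched P p I ω (l ++ [a]) (h + 1) n₀ n₁
      (v - P.vStar p H (h + 1) (POMDP.stateFrom p 0 P.init (l ++ [a])))) :
    Sandwiched P p I ω l h n n₁ (rewEst I ω h (l ++ [a]) n + v
      - P.qStar p H h (POMDP.stateFrom p 0 P.init l) a) := by
  rw [POMDP.stateFrom_append, zero_add, hl] at hv
  rw [P.qStar_eq p H h.2]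
  obtain ⟨⟨y, hy, hvy⟩, z, hz, hzv⟩ := hv
  exact ⟨⟨_, hy.cons hl hn hn', by linarith⟩, _, hz.cons hl hn hn', by linarith⟩

theorem Sandwiched.iSup {y : Fin A → ℝ}
    (hy : ∀ a, Sandwiched P p I ω l h n₀ n₁
      (y a - P.qStar p H h (POMDP.stateFrom p 0 P.init l) a)) :
    Sandwiched P p I ω l h n₀ n₁
      ((⨆ a, y a) - P.vStar p H h (POMDP.stateFrom p 0 P.init l)) := by
  obtain ⟨a, ha⟩ := exists_eq_ciSup_of_finite (f := y)
  obtain ⟨a', ha'⟩ := P.exists_qStar_eq_vStar p H h (POMDP.stateFrom p 0 P.init l)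
  obtain ⟨x, hx, hx'⟩ := (hy a).1
  obtain ⟨z, hz, hz'⟩ := (hy a').2
  have hqv := P.qStar_le_vStar p H h (POMDP.stateFrom p 0 P.init l) a
  have hysup := le_ciSup (Set.finite_range y).bddAbove a'
  exact ⟨⟨x, hx, by linarith⟩, z, hz, by linarith⟩

theorem Sandwiched.abs_le {θ : Fin H → Fin A → Feat k A d} {e : ℝ} {N : ℕ}
    (hg : GoodTape P p I θ e N ω) (hM : 0 < I.M) {h : Fin H} (hN : n₁ ≤ N)
    (hx : Sandwiched P p I ω l h n₀ n₁ x) : |x| ≤ e := by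
  have hdev : ∀ y, IsPathDev P p I ω l h n₀ n₁ y → |y| ≤ e := by
    rintro y ⟨l', idx, hl', -, hsp, hbd, rfl⟩
    exact hg.rew h l' idx hl' hsp fun t ht =>
      (Nat.lt_add_of_pos_right hM).trans_le ((hbd t ht).2.trans hN)
  obtain ⟨⟨y, hy, hxy⟩, z, hz, hzx⟩ := hx
  exact _root_.abs_le.2
    ⟨(_root_.abs_le.1 (hdev z hz)).1.trans hzx, hxy.trans (_root_.abs_le.1 (hdev y hy)).2⟩

end Sandwiched

section Extends

variable {O : Type*} {H k A d : ℕ}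

/-- The total number of entries of the data sets. -/
def dataCount (st : AlgState H k A d) : ℕ := ∑ h, (st.data h).length

/-- Add episodes without changing the data sets. -/
def addEpisodes (st : AlgState H k A d) (n : ℕ) : AlgState H k A d :=
  { st with episodes := st.episodes + n }

/-- Append an entry to the data set of level `h`. -/
def addEntry (st : AlgState H k A d) (h : Fin H) (c : Feat k A d × (Fin A → ℝ)) :
    AlgState H k A d :=
  { st with data := Function.update st.data h (st.data h ++ [c]) }

theorem dataCount_addEntry (st : AlgState H k A d) (h : Fin H) (c : Feat k A d × (Fin A → ℝ)) :
    dataCount (addEntry st h c) = dataCount st + 1 := by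
  have hrest : ∑ i ∈ Finset.univ.erase h, ((addEntry st h c).data i).length
      = ∑ i ∈ Finset.univ.erase h, (st.data i).length := Finset.sum_congr rfl fun i hi =>
    congrArg List.length (Function.update_of_ne (Finset.ne_of_mem_erase hi) _ _)
  have hself : ((addEntry st h c).data h).length = (st.data h).length + 1 :=
    (congrArg List.length (Function.update_self h _ st.data)).trans (List.length_append ..)
  rw [dataCount, dataCount, ← Finset.add_sum_erase _ _ (Finset.mem_univ h), hrest, hself,
    ← Finset.add_sum_erase _ _ (Finset.mem_univ h)]
  ring

/-- The number of episodes that are spent on the feature estimate and on all the reward estimates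
at one level. -/
def levelCost (I : AlgInput k A d O) : ℕ := I.M * (A ^ k + A)

theorem mul_pow_le_levelCost (I : AlgInput k A d O) : I.M * A ^ k ≤ levelCost I :=
  Nat.mul_le_mul_left _ (Nat.le_add_right _ _)

theorem mul_le_levelCost (I : AlgInput k A d O) : I.M * A ≤ levelCost I :=
  Nat.mul_le_mul_left _ (Nat.le_add_left _ _)

/-- The number of episodes that are charged to one entry of a data set: they pay for the recursive
value computations that produce its targets, except for explorations nested in them. -/
def exploreCost (H : ℕ) (I : AlgInput k A d O) : ℕ := A * (H * levelCost I)

/-- The invariant of the data sets: the features were uncovered when they were added and, as long as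
no more than `N` episodes have been used, the targets are the values of the functionals `θ h a` up
to `2 * e`. -/
structure Sound (I : AlgInput k A d O) (θ : Fin H → Fin A → Feat k A d) (e : ℝ) (N : ℕ)
    (st : AlgState H k A d) : Prop where
  uncovered : ∀ h, Uncovered I.lam I.eps ((A : ℝ) ^ k) (st.data h)
  accurate : st.episodes ≤ N → ∀ h, ∀ c ∈ st.data h, ∀ a, |c.2 a - θ h a ⬝ᵥ c.1| ≤ 2 * e

/-- The state `st'` is reached from `st` without a change of the data sets below level `h`, and with
at most `c` new episodes in addition to those charged to the new entries of the data sets. -/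
structure Extends (I : AlgInput k A d O) (θ : Fin H → Fin A → Feat k A d) (e : ℝ) (N h c : ℕ)
    (st st' : AlgState H k A d) : Prop where
  data_eq : ∀ h' : Fin H, (h' : ℕ) < h → st'.data h' = st.data h'
  episodes_le : st.episodes ≤ st'.episodes
  count_le : dataCount st ≤ dataCount st'
  cost : st'.episodes + dataCount st * exploreCost H I
    ≤ st.episodes + c + dataCount st' * exploreCost H I
  sound : Sound I θ e N st → Sound I θ e N st'

variable {I : AlgInput k A d O} {θ : Fin H → Fin A → Feat k A d} {e : ℝ} {N h h' c c' : ℕ}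
  {st st' st'' : AlgState H k A d}

theorem Sound.addEpisodes (hst : Sound I θ e N st) (n : ℕ) : Sound I θ e N (addEpisodes st n) :=
  ⟨hst.uncovered, fun hN => hst.accurate ((Nat.le_add_right _ n).trans hN)⟩

theorem Sound.addEntry (hst : Sound I θ e N st) {h : Fin H} {x : Feat k A d} {y : Fin A → ℝ}
    (hxR : x ⬝ᵥ x ≤ (A : ℝ) ^ k) (hx : ¬ sigmaInvNorm I.lam (st.data h) x ≤ I.eps)
    (hy : st.episodes ≤ N → ∀ a, |y a - θ h a ⬝ᵥ x| ≤ 2 * e) :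
    Sound I θ e N (addEntry st h (x, y)) where
  uncovered := (Function.forall_update_iff st.data
    fun _ D => Uncovered I.lam I.eps ((A : ℝ) ^ k) D).2
      ⟨.append _ _ _ (hst.uncovered h) hxR hx, fun h' _ => hst.uncovered h'⟩
  accurate hN := (Function.forall_update_iff st.data
    fun h D => ∀ c ∈ D, ∀ a, |c.2 a - θ h a ⬝ᵥ c.1| ≤ 2 * e).2
      ⟨List.forall_mem_append.2 ⟨hst.accurate hN h, by simpa using hy hN⟩,
        fun h' _ => hst.accurate hN h'⟩

namespace Extends

theorem refl (st : AlgState H k A d) : Extends I θ e N h 0 st st :=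
  ⟨fun _ _ => rfl, le_rfl, le_rfl, le_rfl, id⟩

theorem trans (h₁ : Extends I θ e N h c st st') (h₂ : Extends I θ e N h c' st' st'') :
    Extends I θ e N h (c + c') st st'' where
  data_eq i hi := (h₂.data_eq i hi).trans (h₁.data_eq i hi)
  episodes_le := h₁.episodes_le.trans h₂.episodes_le
  count_le := h₁.count_le.trans h₂.count_le
  cost := by linarith [h₁.cost, h₂.cost]
  sound hst := h₂.sound (h₁.sound hst)

theorem addEpisodes (st : AlgState H k A d) (n : ℕ) :
    Extends I θ e N h n st (addEpisodes st n) :=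
  ⟨fun _ _ => rfl, Nat.le_add_right _ _, le_rfl, le_rfl, fun hst => hst.addEpisodes n⟩

theorem mono (hext : Extends I θ e N h c st st') (hh : h' ≤ h) (hc : c ≤ c') :
    Extends I θ e N h' c' st st' :=
  ⟨fun i hi => hext.data_eq i (hi.trans_le hh), hext.episodes_le, hext.count_le,
    hext.cost.trans (by gcongr), hext.sound⟩

theorem addEntry {h : Fin H} {x : Feat k A d} {y : Fin A → ℝ}
    (hext : Extends I θ e N (h + 1) (exploreCost H I) st st') (hxR : x ⬝ᵥ x ≤ (A : ℝ) ^ k)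
    (hx : ¬ sigmaInvNorm I.lam (st.data h) x ≤ I.eps)
    (hy : Sound I θ e N st → st'.episodes ≤ N → ∀ a, |y a - θ h a ⬝ᵥ x| ≤ 2 * e) :
    Extends I θ e N h 0 st (addEntry st' h (x, y)) where
  data_eq i hi := (Function.update_of_ne (Fin.ne_of_lt hi) _ _).trans
    (hext.data_eq i (hi.trans (Nat.lt_succ_self _)))
  episodes_le := hext.episodes_le
  count_le := hext.count_le.trans (by simp only [dataCount_addEntry, Nat.le_add_right])
  cost := hext.cost.trans_eq (by rw [dataCount_addEntry]; ring)
  sound hst := (hext.sound hst).addEntry hxR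
    (by rwa [hext.data_eq h (Nat.lt_succ_self _)]) (hy hst)

end Extends

end Extends

section Steps

variable {O : Type*} {H k A d : ℕ} [NeZero A]

/-- The action with the largest estimated value at a state of the algorithm, after the actions `l`,
according to a fresh feature estimate. -/
noncomputable def greedyAction (I : AlgInput k A d O) (ω : Tape H k A O) (h : Fin H)
    (l : List (Fin A)) (st : AlgState H k A d) : Fin A :=
  I.amax fun a => thetaHat I.lam (st.data h) a ⬝ᵥ featEst I ω h l st.episodes

/-- A fresh feature estimate after the actions `l` is covered by the data set of level `h`. -/
def Covered (I : AlgInput k A d O) (ω : Tape H k A O) (h : Fin H) (l : List (Fin A))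
    (st : AlgState H k A d) : Prop :=
  sigmaInvNorm I.lam (st.data h) (featEst I ω h l st.episodes) ≤ I.eps

/-- The targets computed by an exploration for the actions of `la` in turn (zero for all other
actions), and the state that is reached by it. -/
noncomputable def exploreTargets (I : AlgInput k A d O) (ω : Tape H k A O) (h : Fin H)
    (l : List (Fin A)) (next : List (Fin A) → AlgState H k A d → ℝ × AlgState H k A d)
    (st : AlgState H k A d) (la : List (Fin A)) : (Fin A → ℝ) × AlgState H k A d :=
  la.foldl
    (fun acc a =>
      let r := rewEst I ω h (l ++ [a]) acc.2.episodes
      let out := next (l ++ [a]) (addEpisodes acc.2 I.M)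
      (Function.update acc.1 a (r + out.1), out.2))
    (fun _ => 0, st)

theorem M_le_levelCost (I : AlgInput k A d O) : I.M ≤ levelCost I :=
  (Nat.le_mul_of_pos_right _ (Nat.pos_of_neZero A)).trans (mul_le_levelCost I)

variable {I : AlgInput k A d O} {ω : Tape H k A O} {h : Fin H} {l : List (Fin A)}
  {next : List (Fin A) → AlgState H k A d → ℝ × AlgState H k A d}

theorem exploreTargets_concat (st : AlgState H k A d) (la : List (Fin A)) (a : Fin A) :
    exploreTargets I ω h l next st (la ++ [a])
      = (Function.update (exploreTargets I ω h l next st la).1 a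
          (rewEst I ω h (l ++ [a]) (exploreTargets I ω h l next st la).2.episodes
            + (next (l ++ [a]) (addEpisodes (exploreTargets I ω h l next st la).2 I.M)).1),
        (next (l ++ [a]) (addEpisodes (exploreTargets I ω h l next st la).2 I.M)).2) :=
  List.foldl_concat ..

theorem explore_eq (x : Feat k A d) (st : AlgState H k A d) :
    explore I ω h l x next st
      = ((exploreTargets I ω h l next st (List.finRange A)).1,
        addEntry (exploreTargets I ω h l next st (List.finRange A)).2 h
          (x, (exploreTargets I ω h l next st (List.finRange A)).1)) := rfl

theorem computeV_of_covered {r : ℕ} (hr : h + (r + 2) = H) {st : AlgState H k A d}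
    (hcov : Covered I ω h l st) :
    computeV I ω (r + 2) h hr l st
      = (rewEst I ω h (l ++ [greedyAction I ω h l st]) (st.episodes + I.M * A ^ k)
          + (computeV I ω (r + 1) (h + 1) (by omega) (l ++ [greedyAction I ω h l st])
            (addEpisodes (addEpisodes st (I.M * A ^ k)) I.M)).1,
        (computeV I ω (r + 1) (h + 1) (by omega) (l ++ [greedyAction I ω h l st])
          (addEpisodes (addEpisodes st (I.M * A ^ k)) I.M)).2) := by
  rw [computeV]
  exact if_pos hcov

theorem computeV_of_not_covered {r : ℕ} (hr : h + (r + 2) = H) {st : AlgState H k A d}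
    (hcov : ¬ Covered I ω h l st) :
    computeV I ω (r + 2) h hr l st
      = (⨆ a, (explore I ω h l (featEst I ω h l st.episodes)
          (computeV I ω (r + 1) (h + 1) (by omega)) (addEpisodes st (I.M * A ^ k))).1 a,
        (explore I ω h l (featEst I ω h l st.episodes)
          (computeV I ω (r + 1) (h + 1) (by omega)) (addEpisodes st (I.M * A ^ k))).2) := by
  rw [computeV]
  exact if_neg hcov

theorem rollout_some_fst (r : ℕ) {h : ℕ} (hr : h + r = H) (b : Fin H × List (Fin A) × Feat k A d)
    (st : AlgState H k A d) : (rollout I ω r h hr l (some b) st).1 = some b := by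
  induction r generalizing h l st with
  | zero => rw [rollout]
  | succ r ih =>
    rw [rollout]
    simp only [reduceCtorEq, false_and, if_false]
    exact ih _ _

theorem rollout_snd_snd (r : ℕ) {h : ℕ} (hr : h + r = H)
    (bad : Option (Fin H × List (Fin A) × Feat k A d)) (st : AlgState H k A d) :
    (rollout I ω r h hr l bad st).2.2 = addEpisodes st (r * (I.M * A ^ k)) := by
  induction r generalizing h l bad st with
  | zero => rw [rollout, addEpisodes, zero_mul, add_zero]
  | succ r ih =>
    rw [rollout, ih, addEpisodes, addEpisodes, Nat.succ_mul, add_assoc, add_comm (r * _)]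

theorem rollout_of_covered {r : ℕ} (hr : h + (r + 1) = H) {st : AlgState H k A d}
    (hcov : Covered I ω h l st) :
    rollout I ω (r + 1) h hr l none st
      = rollout I ω r (h + 1) (by omega) (l ++ [greedyAction I ω h l st]) none
        (addEpisodes st (I.M * A ^ k)) := by
  rw [rollout]
  exact congrArg (fun bad => rollout I ω r (h + 1) _ _ bad _)
    (if_neg fun hbad => hbad.2 hcov)

theorem rollout_fst_of_not_covered {r : ℕ} (hr : h + (r + 1) = H) {st : AlgState H k A d}
    (hcov : ¬ Covered I ω h l st) :
    (rollout I ω (r + 1) h hr l none st).1 = some (h, l, featEst I ω h l st.episodes) := by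
  rw [rollout]
  refine (congrArg (fun bad => (rollout I ω r (h + 1) _ _ bad _).1) (if_pos ⟨rfl, hcov⟩)).trans ?_
  exact rollout_some_fst ..

theorem exists_featEst_of_rollout_eq_some (hM : 0 < I.M) (r : ℕ) {h : ℕ} (hr : h + r = H)
    (hl : l.length = h) {st : AlgState H k A d} {h' : Fin H} {l' : List (Fin A)}
    {x : Feat k A d} (hroll : (rollout I ω r h hr l none st).1 = some (h', l', x)) :
    l'.length = h' ∧ ¬ sigmaInvNorm I.lam (st.data h') x ≤ I.eps ∧
      ∃ m < st.episodes + r * (I.M * A ^ k), x = featEst I ω h' l' m := by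
  induction r generalizing h l st with
  | zero => simp [rollout] at hroll
  | succ r ih =>
    obtain ⟨h, rfl⟩ : ∃ i : Fin H, (i : ℕ) = h := ⟨⟨h, by omega⟩, rfl⟩
    by_cases hcov : Covered I ω h l st
    · rw [rollout_of_covered hr hcov] at hroll
      obtain ⟨hl', hx, m, hm, hxm⟩ :=
        ih _ (by simp [hl]) hroll
      exact ⟨hl', hx, m, hm.trans_eq (by rw [addEpisodes]; ring), hxm⟩
    · rw [rollout_fst_of_not_covered hr hcov] at hroll
      cases hroll
      have hpos : 0 < (r + 1) * (I.M * A ^ k) :=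
        Nat.mul_pos r.succ_pos (Nat.mul_pos hM (Nat.pow_pos (Nat.pos_of_neZero A)))
      exact ⟨hl, hcov, st.episodes, Nat.lt_add_of_pos_right hpos, rfl⟩

theorem mainLoop_succ_of_eq_none (f : ℕ) {st st' : AlgState H k A d}
    (hroll : rollout I ω H 0 (Nat.zero_add H) [] none st = (none, l, st')) :
    mainLoop I ω (f + 1) st = some (l, st') := by
  rw [mainLoop, hroll]

theorem mainLoop_succ_of_eq_some (f : ℕ) {st st' : AlgState H k A d} {l' : List (Fin A)}
    {x : Feat k A d}
    (hroll : rollout I ω H 0 (Nat.zero_add H) [] none st = (some (h, l, x), l', st')) :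
    mainLoop I ω (f + 1) st = mainLoop I ω f
      (explore I ω h l x (computeV I ω (H - (h + 1)) (h + 1) (by omega)) st').2 := by
  rw [mainLoop, hroll]

end Steps

section Runs

variable {S O : Type*} [MeasurableSpace S] [MeasurableSpace O] {H k A d : ℕ} [NeZero A]

/-- On the tape `ω` the estimates are accurate, uncovered data sets have at most `n` entries, and
greedy actions at covered features are optimal. -/
structure Favorable (P : POMDP S O A) (p : ℕ → S → Fin A → S) (I : AlgInput k A d O)
    (θ : Fin H → Fin A → Feat k A d) (e : ℝ) (N n : ℕ) (ω : Tape H k A O) : Prop where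
  good : GoodTape P p I θ e N ω
  M_pos : 0 < I.M
  norm_le : ∀ o, ‖I.ψ o‖ ≤ 1
  length_le : ∀ D : Dataset k A d, Uncovered I.lam I.eps ((A : ℝ) ^ k) D → D.length ≤ n
  greedy : ∀ (h : Fin H) (l : List (Fin A)) (st : AlgState H k A d), l.length = h →
    Sound I θ e N st → st.episodes < N → Covered I ω h l st →
    P.qStar p H h (POMDP.stateFrom p 0 P.init l) (greedyAction I ω h l st)
      = P.vStar p H h (POMDP.stateFrom p 0 P.init l)

/-- A correct computation of the value at step `h` after the actions `l`, from the state `st`. -/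
structure CorrectValue (P : POMDP S O A) (p : ℕ → S → Fin A → S) (I : AlgInput k A d O)
    (θ : Fin H → Fin A → Feat k A d) (e : ℝ) (N : ℕ) (ω : Tape H k A O) (h c : ℕ)
    (l : List (Fin A)) (st : AlgState H k A d) (out : ℝ × AlgState H k A d) : Prop where
  extends_state : Extends I θ e N h c st out.2
  sandwiched : Sound I θ e N st → out.2.episodes ≤ N →
    Sandwiched P p I ω l h st.episodes out.2.episodes
      (out.1 - P.vStar p H h (POMDP.stateFrom p 0 P.init l))

variable {P : POMDP S O A} {p : ℕ → S → Fin A → S} {I : AlgInput k A d O}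
  {θ : Fin H → Fin A → Feat k A d} {e : ℝ} {N n : ℕ} {ω : Tape H k A O} {h : Fin H}
  {l : List (Fin A)} {next : List (Fin A) → AlgState H k A d → ℝ × AlgState H k A d} {c : ℕ}

theorem exploreTargets_spec (hl : l.length = h)
    (hnext : ∀ a st', CorrectValue P p I θ e N ω (h + 1) c (l ++ [a]) st' (next (l ++ [a]) st'))
    (st : AlgState H k A d) {la : List (Fin A)} (hla : la.Nodup) :
    Extends I θ e N (h + 1) (la.length * (I.M + c)) st (exploreTargets I ω h l next st la).2 ∧
    (Sound I θ e N st → (exploreTargets I ω h l next st la).2.episodes ≤ N → ∀ a ∈ la,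
      Sandwiched P p I ω l h st.episodes (exploreTargets I ω h l next st la).2.episodes
        ((exploreTargets I ω h l next st la).1 a
          - P.qStar p H h (POMDP.stateFrom p 0 P.init l) a)) := by
  induction la using List.reverseRecOn with
  | nil =>
    rw [List.length_nil, zero_mul]
    exact ⟨Extends.refl st, fun _ _ _ ha => absurd ha List.not_mem_nil⟩
  | append_singleton la a ih =>
    have hndup := List.nodup_append.1 hla
    obtain ⟨hext, hsand⟩ := ih hndup.1
    rw [exploreTargets_concat, List.length_append, List.length_singleton]
    set acc := exploreTargets I ω h l next st la
    obtain ⟨hext', hsand'⟩ := hnext a (addEpisodes acc.2 I.M)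
    have hep : acc.2.episodes + I.M ≤ _ := hext'.episodes_le
    refine ⟨((hext.trans (.addEpisodes _ I.M)).trans hext').mono le_rfl
      (by rw [add_one_mul, add_assoc]), fun hst hN a' ha' => ?_⟩
    dsimp only at hN ⊢
    rcases List.mem_append.1 ha' with ha' | ha'
    · rw [Function.update_of_ne (hndup.2.2 a' ha' a (List.mem_singleton_self a))]
      have hle := (Nat.le_add_right _ I.M).trans hep
      exact (hsand hst (hle.trans hN) a' ha').mono le_rfl hle
    · obtain rfl := List.mem_singleton.1 ha'
      rw [Function.update_self]
      exact (Sandwiched.cons hl le_rfl hep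
        (hsand' ((hext.sound hst).addEpisodes _) hN)).mono hext.episodes_le le_rfl

theorem explore_spec (hF : Favorable P p I θ e N n ω) (hl : l.length = h)
    (hnext : ∀ a st', CorrectValue P p I θ e N ω (h + 1) c (l ++ [a]) st' (next (l ++ [a]) st'))
    (hc : I.M + c ≤ H * levelCost I) {st : AlgState H k A d} {m : ℕ} (hm : m < st.episodes)
    (hx : ¬ sigmaInvNorm I.lam (st.data h) (featEst I ω h l m) ≤ I.eps) :
    Extends I θ e N h 0 st (explore I ω h l (featEst I ω h l m) next st).2 ∧
    dataCount st < dataCount (explore I ω h l (featEst I ω h l m) next st).2 ∧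
    (Sound I θ e N st → (explore I ω h l (featEst I ω h l m) next st).2.episodes ≤ N → ∀ a,
      Sandwiched P p I ω l h st.episodes (explore I ω h l (featEst I ω h l m) next st).2.episodes
        ((explore I ω h l (featEst I ω h l m) next st).1 a
          - P.qStar p H h (POMDP.stateFrom p 0 P.init l) a)) := by
  obtain ⟨hext, hsand⟩ := exploreTargets_spec hl hnext st (List.nodup_finRange A)
  rw [explore_eq]
  set res := exploreTargets I ω h l next st (List.finRange A)
  have hsand' := fun hst hN a => hsand hst hN a (List.mem_finRange a)
  rw [List.length_finRange] at hext
  refine ⟨(hext.mono le_rfl (Nat.mul_le_mul_left A hc)).addEntry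
    (featEst_dotProduct_self_le I ω hF.norm_le h l m) hx fun hst hN a => ?_, ?_, hsand'⟩
  · have hy := abs_le.1 ((hsand' hst hN a).abs_le hF.good hF.M_pos hN)
    have hθ := abs_le.1 (hF.good.feat h a l m hl (hm.trans_le (hext.episodes_le.trans hN)))
    exact abs_le.2 ⟨by linarith, by linarith⟩
  · rw [dataCount_addEntry]
    exact Nat.lt_succ_of_le hext.count_le

namespace CorrectValue

theorem last (hl : l.length = H) (st : AlgState H k A d) :
    CorrectValue P p I θ e N ω H 0 l st (0, st) where
  extends_state := Extends.refl st
  sandwiched _ _ := by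
    rw [POMDP.vStar_self, sub_zero]
    exact sandwiched_last hl

theorem lastStep (hh : (h : ℕ) + 1 = H) (hl : l.length = h) (st : AlgState H k A d) :
    CorrectValue P p I θ e N ω h (I.M * A) l st
      (⨆ a : Fin A, rewEst I ω h (l ++ [a]) (st.episodes + I.M * a),
        addEpisodes st (I.M * A)) where
  extends_state := Extends.addEpisodes st _
  sandwiched _ _ := Sandwiched.iSup fun a => by
    have hblock : st.episodes + I.M * a + I.M ≤ st.episodes + I.M * A := by
      rw [add_assoc, ← Nat.mul_succ]
      gcongr
      exact a.2
    have hlast : Sandwiched P p I ω (l ++ [a]) (h + 1) (st.episodes + I.M * A)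
        (st.episodes + I.M * A)
        (0 - P.vStar p H (h + 1) (POMDP.stateFrom p 0 P.init (l ++ [a]))) := by
      rw [hh, POMDP.vStar_self, sub_zero]
      exact sandwiched_last (by simp [hl, hh])
    have hcons := Sandwiched.cons hl hblock le_rfl hlast
    rw [add_zero] at hcons
    exact hcons.mono (Nat.le_add_right _ _) le_rfl

theorem of_covered (hF : Favorable P p I θ e N n ω) (hl : l.length = h) {st : AlgState H k A d}
    (hcov : Covered I ω h l st) {out : ℝ × AlgState H k A d}
    (hout : CorrectValue P p I θ e N ω (h + 1) c (l ++ [greedyAction I ω h l st])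
      (addEpisodes (addEpisodes st (I.M * A ^ k)) I.M) out) :
    CorrectValue P p I θ e N ω h (I.M * A ^ k + I.M + c) l st
      (rewEst I ω h (l ++ [greedyAction I ω h l st]) (st.episodes + I.M * A ^ k) + out.1,
        out.2) where
  extends_state := ((Extends.addEpisodes st _).trans (.addEpisodes _ _)).trans
    (hout.extends_state.mono (Nat.le_succ _) le_rfl)
  sandwiched hst hN := by
    have hep : st.episodes + I.M * A ^ k + I.M ≤ out.2.episodes := hout.extends_state.episodes_le
    have hpos := hF.M_pos
    rw [← hF.greedy h l st hl hst (by dsimp only at hN; omega) hcov]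
    exact (Sandwiched.cons hl le_rfl hep (hout.sandwiched ((hst.addEpisodes _).addEpisodes _)
      hN)).mono (Nat.le_add_right _ _) le_rfl

theorem of_not_covered (hF : Favorable P p I θ e N n ω) (hl : l.length = h)
    (hnext : ∀ a st', CorrectValue P p I θ e N ω (h + 1) c (l ++ [a]) st' (next (l ++ [a]) st'))
    (hc : I.M + c ≤ H * levelCost I) {st : AlgState H k A d} (hcov : ¬ Covered I ω h l st) :
    CorrectValue P p I θ e N ω h (I.M * A ^ k) l st
      (⨆ a, (explore I ω h l (featEst I ω h l st.episodes) next
          (addEpisodes st (I.M * A ^ k))).1 a,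
        (explore I ω h l (featEst I ω h l st.episodes) next
          (addEpisodes st (I.M * A ^ k))).2) := by
  have hpos : 0 < I.M * A ^ k := Nat.mul_pos hF.M_pos (Nat.pow_pos (Nat.pos_of_neZero A))
  obtain ⟨hext, -, hsand⟩ := explore_spec hF hl hnext hc (st := addEpisodes st (I.M * A ^ k))
    (Nat.lt_add_of_pos_right hpos) hcov
  exact ⟨(Extends.addEpisodes st _).trans hext, fun hst hN => Sandwiched.iSup fun a =>
    (hsand (hst.addEpisodes _) hN a).mono (Nat.le_add_right _ _) le_rfl⟩

theorem mono {c' : ℕ} {h : ℕ} {st : AlgState H k A d} {out : ℝ × AlgState H k A d}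
    (hout : CorrectValue P p I θ e N ω h c l st out) (hc : c ≤ c') :
    CorrectValue P p I θ e N ω h c' l st out :=
  ⟨hout.extends_state.mono le_rfl hc, hout.sandwiched⟩

end CorrectValue

theorem correctValue_computeV (hF : Favorable P p I θ e N n ω) (r : ℕ) {h : ℕ} (hr : h + r = H)
    (hl : l.length = h) (st : AlgState H k A d) :
    CorrectValue P p I θ e N ω h (r * levelCost I) l st (computeV I ω r h hr l st) := by
  induction r using Nat.strong_induction_on generalizing h l st with
  | _ r ih =>
  match r with
  | 0 =>
    rw [computeV, zero_mul]
    obtain rfl : h = H := hr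
    exact CorrectValue.last hl st
  | 1 =>
    rw [computeV, one_mul]
    exact (CorrectValue.lastStep (h := ⟨h, by omega⟩) hr hl st).mono (mul_le_levelCost I)
  | r + 2 =>
    obtain ⟨h, rfl⟩ : ∃ i : Fin H, (i : ℕ) = h := ⟨⟨h, by omega⟩, rfl⟩
    have hnext : ∀ a st', CorrectValue P p I θ e N ω (h + 1) ((r + 1) * levelCost I) (l ++ [a]) st'
        (computeV I ω (r + 1) (h + 1) (by omega) (l ++ [a]) st') := fun a st' =>
      ih (r + 1) (Nat.lt_succ_self _) _ (by simp [hl]) st'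
    by_cases hcov : Covered I ω h l st
    · rw [computeV_of_covered hr hcov]
      refine (CorrectValue.of_covered hF hl hcov (hnext _ _)).mono ?_
      have hA : I.M ≤ I.M * A := Nat.le_mul_of_pos_right _ (Nat.pos_of_neZero A)
      rw [show (r + 2) * levelCost I = I.M * A ^ k + I.M * A + (r + 1) * levelCost I by
        rw [levelCost]; ring]
      gcongr
    · rw [computeV_of_not_covered hr hcov]
      refine (CorrectValue.of_not_covered hF hl hnext ?_ hcov).mono
        ((mul_pow_le_levelCost I).trans (Nat.le_mul_of_pos_left _ (Nat.succ_pos _)))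
      calc I.M + (r + 1) * levelCost I ≤ levelCost I + (r + 1) * levelCost I := by
            gcongr
            exact M_le_levelCost I
        _ = (r + 2) * levelCost I := by ring
        _ ≤ H * levelCost I := by gcongr; omega

theorem pathMean_of_rollout_eq_none (hF : Favorable P p I θ e N n ω) (r : ℕ) {h : ℕ}
    (hr : h + r = H) (hl : l.length = h) {st : AlgState H k A d}
    (hst : Sound I θ e N st) (hN : st.episodes + r * (I.M * A ^ k) ≤ N)
    (hnone : (rollout I ω r h hr l none st).1 = none) :
    (rollout I ω r h hr l none st).2.1.length = H ∧
      P.pathMean p 0 P.init (rollout I ω r h hr l none st).2.1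
        = P.pathMean p 0 P.init l + P.vStar p H h (POMDP.stateFrom p 0 P.init l) := by
  induction r generalizing h l st with
  | zero =>
    obtain rfl : h = H := hr
    rw [rollout, POMDP.vStar_self, add_zero]
    exact ⟨hl, rfl⟩
  | succ r ih =>
    obtain ⟨h, rfl⟩ : ∃ i : Fin H, (i : ℕ) = h := ⟨⟨h, by omega⟩, rfl⟩
    have hcov : Covered I ω h l st := by
      by_contra hcov
      rw [rollout_fst_of_not_covered hr hcov] at hnone
      cases hnone
    have hpos : 0 < I.M * A ^ k := Nat.mul_pos hF.M_pos (Nat.pow_pos (Nat.pos_of_neZero A))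
    have hgreedy := hF.greedy h l st hl hst (by nlinarith) hcov
    rw [rollout_of_covered hr hcov] at hnone ⊢
    obtain ⟨hlen, hmean⟩ := ih _ (by simp [hl])
      (hst.addEpisodes _) (by rw [HSEPOMDP.addEpisodes]; linarith) hnone
    refine ⟨hlen, hmean.trans ?_⟩
    rw [POMDP.pathMean_append, POMDP.stateFrom_append, zero_add, hl, ← hgreedy,
      P.qStar_eq p H h.2, add_assoc]

theorem explore_rollout_spec (hF : Favorable P p I θ e N n ω) {st st' : AlgState H k A d}
    {l' : List (Fin A)} {x : Feat k A d}
    (hroll : rollout I ω H 0 (Nat.zero_add H) [] none st = (some (h, l, x), l', st')) :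
    Extends I θ e N 0 (H * levelCost I) st
      (explore I ω h l x (computeV I ω (H - (h + 1)) (h + 1) (by omega)) st').2 ∧
    dataCount st
      < dataCount (explore I ω h l x (computeV I ω (H - (h + 1)) (h + 1) (by omega)) st').2 := by
  obtain ⟨hl, hx, m, hm, rfl⟩ := exists_featEst_of_rollout_eq_some hF.M_pos H (Nat.zero_add H)
    List.length_nil (congrArg Prod.fst hroll)
  obtain rfl : addEpisodes st (H * (I.M * A ^ k)) = st' := by
    rw [← rollout_snd_snd H (Nat.zero_add H) none st, hroll]
  have hcost : I.M + (H - (h + 1)) * levelCost I ≤ H * levelCost I :=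
    calc I.M + (H - (h + 1)) * levelCost I ≤ levelCost I + (H - (h + 1)) * levelCost I := by
          gcongr
          exact M_le_levelCost I
      _ = (H - (h + 1) + 1) * levelCost I := by ring
      _ ≤ H * levelCost I := by gcongr; omega
  have hnext : ∀ a st', CorrectValue P p I θ e N ω (h + 1) ((H - (h + 1)) * levelCost I)
      (l ++ [a]) st' (computeV I ω (H - (h + 1)) (h + 1) (by omega) (l ++ [a]) st') :=
    fun a st' => correctValue_computeV hF _ (by omega) (by simp [hl]) st'
  obtain ⟨hext, hlt, -⟩ :=
    explore_spec hF hl hnext hcost (st := addEpisodes st (H * (I.M * A ^ k))) hm hx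
  exact ⟨((Extends.addEpisodes st _).trans (hext.mono (Nat.zero_le _) le_rfl)).mono le_rfl
    (Nat.mul_le_mul_left H (mul_pow_le_levelCost I)), hlt⟩

theorem dataCount_le (hF : Favorable P p I θ e N n ω) {st : AlgState H k A d}
    (hst : Sound I θ e N st) : dataCount st ≤ H * n :=
  (Finset.sum_le_card_nsmul _ _ n fun h _ => hF.length_le _ (hst.uncovered h)).trans_eq
    (by rw [Finset.card_univ, Fintype.card_fin, smul_eq_mul])

theorem exists_mainLoop_eq_some (hF : Favorable P p I θ e N n ω) (hp : P.IsDeterministic p)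
    (hN : H * n * ((A + 1) * (H * levelCost I)) + H * levelCost I ≤ N) (f : ℕ)
    {st : AlgState H k A d} (hst : Sound I θ e N st) (hf : H * n < f + dataCount st)
    (hep : st.episodes ≤ dataCount st * ((A + 1) * (H * levelCost I))) :
    ∃ l st', mainLoop I ω f st = some (l, st') ∧ P.IsOptimalActions H l ∧ st'.episodes ≤ N := by
  induction f generalizing st with
  | zero => exact absurd (dataCount_le hF hst) (by omega)
  | succ f ih =>
    rcases hroll : rollout I ω H 0 (Nat.zero_add H) [] none st with ⟨_ | ⟨h, l, x⟩, l', st'⟩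
    · have hle : st.episodes + H * (I.M * A ^ k) ≤ N :=
        (add_le_add (hep.trans (Nat.mul_le_mul_right _ (dataCount_le hF hst)))
          (Nat.mul_le_mul_left H (mul_pow_le_levelCost I))).trans hN
      obtain ⟨hlen, hmean⟩ := pathMean_of_rollout_eq_none hF H (Nat.zero_add H) List.length_nil
        hst hle (congrArg Prod.fst hroll)
      obtain rfl : addEpisodes st (H * (I.M * A ^ k)) = st' := by
        rw [← rollout_snd_snd H (Nat.zero_add H) none st, hroll]
      rw [hroll] at hlen hmean
      exact ⟨l', _, mainLoop_succ_of_eq_none f hroll,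
        POMDP.isOptimalActions_of_pathMean_eq H hp hlen (hmean.trans (zero_add _)), hle⟩
    · obtain ⟨hext, hlt⟩ := explore_rollout_spec hF hroll
      rw [mainLoop_succ_of_eq_some f hroll]
      refine ih (hext.sound hst) (by omega) ?_
      have hcost := hext.cost
      rw [exploreCost] at hcost
      nlinarith [Nat.mul_le_mul_right (H * levelCost I) (Nat.succ_le_of_lt hlt)]

theorem exists_outputs (hF : Favorable P p I θ e N n ω) (hp : P.IsDeterministic p)
    (hN : H * n * ((A + 1) * (H * levelCost I)) + H * levelCost I ≤ N) :
    ∃ l N', Outputs I ω l N' ∧ P.IsOptimalActions H l ∧ N' ≤ N * (H + k) := by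
  have hst : Sound I θ e N ⟨0, fun _ => []⟩ := ⟨fun _ => .nil, fun _ _ _ hc => by cases hc⟩
  obtain ⟨l, st, hrun, hl, hst⟩ := exists_mainLoop_eq_some hF hp hN (H * n + 1) hst
    (Nat.lt_add_right _ (Nat.lt_succ_self _)) (Nat.zero_le _)
  exact ⟨l, _, ⟨_, st, hrun, rfl⟩, hl, Nat.mul_le_mul_right _ hst⟩

end Runs

/-! ## Optimality of the greedy actions -/

section Greedy

variable {S O : Type*} [MeasurableSpace S] [MeasurableSpace O] {H k A d : ℕ} [NeZero A]
  {P : POMDP S O A} {p : ℕ → S → Fin A → S} {h : Fin H}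

theorem POMDP.qStar_eq_vStar_of_abs_sub_lt {s : S} {Δ : ℝ}
    (hgap : ∀ a, 0 < P.gap p H h s a → Δ ≤ P.gap p H h s a) {f : Fin A → ℝ}
    (hf : ∀ a, |f a - P.qStar p H h s a| < Δ / 2) {a : Fin A} (ha : ∀ a', f a' ≤ f a) :
    P.qStar p H h s a = P.vStar p H h s := by
  obtain ⟨a', ha'⟩ := P.exists_qStar_eq_vStar p H h s
  by_contra hne
  have hgap_a := hgap a (sub_pos.2 (lt_of_le_of_ne (P.qStar_le_vStar p H h s a) hne))
  rw [POMDP.gap] at hgap_a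
  linarith [ha a', (abs_lt.1 (hf a)).2, (abs_lt.1 (hf a')).1]

variable {I : AlgInput k A d O} {θ : Fin H → Fin A → Feat k A d} {e Θ : ℝ} {N n : ℕ}
  {ω : Tape H k A O}

theorem GoodTape.abs_thetaHat_dotProduct_featEst_sub_le (hg : GoodTape P p I θ e N ω)
    (hlam : 0 < I.lam) (heps : 0 ≤ I.eps) (he : 0 ≤ e) {l : List (Fin A)} (hl : l.length = h)
    {st : AlgState H k A d} (hst : Sound I θ e N st) (hN : st.episodes < N)
    (hn : (st.data h).length ≤ n) (hcov : Covered I ω h l st) {a : Fin A}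
    (hθ : √(θ h a ⬝ᵥ θ h a) ≤ Θ) :
    |thetaHat I.lam (st.data h) a ⬝ᵥ featEst I ω h l st.episodes
        - P.qStar p H h (POMDP.stateFrom p 0 P.init l) a|
      ≤ I.eps * (√n * (2 * e) + √I.lam * Θ) + e := by
  have hridge := abs_thetaHat_dotProduct_sub_le hlam (st.data h) (featEst I ω h l st.episodes) a
    (θ h a) (by positivity) fun c hc => hst.accurate hN.le h c hc a
  have hcovered : sigmaInvNorm I.lam (st.data h) (featEst I ω h l st.episodes)
      * (√(st.data h).length * (2 * e) + √I.lam * √(θ h a ⬝ᵥ θ h a))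
      ≤ I.eps * (√n * (2 * e) + √I.lam * Θ) := by
    have hn' : ((st.data h).length : ℝ) ≤ n := Nat.cast_le.2 hn
    gcongr
    exact hcov
  exact (abs_sub_le _ _ _).trans
    (add_le_add (hridge.trans hcovered) (hg.feat h a l st.episodes hl hN))

theorem GoodTape.favorable (hg : GoodTape P p I θ e N ω) (hM : 0 < I.M)
    (hψ : ∀ o, ‖I.ψ o‖ ≤ 1) (hlam : 0 < I.lam) (heps : 0 ≤ I.eps) (he : 0 ≤ e)
    (hamax : ∀ (f : Fin A → ℝ) (a : Fin A), f a ≤ f (I.amax f))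
    (hθ : ∀ h a, √(θ h a ⬝ᵥ θ h a) ≤ Θ) {Δ : ℝ}
    (hgap : ∀ (h : Fin H) (s : S) (a : Fin A), 0 < P.gap p H h s a → Δ ≤ P.gap p H h s a)
    (hn : ∀ m : ℕ, (1 + I.eps ^ 2) ^ m ≤ (1 + m * (A : ℝ) ^ k / I.lam) ^ (A ^ k * d) → m ≤ n)
    (hΔ : I.eps * (√n * (2 * e) + √I.lam * Θ) + e < Δ / 2) : Favorable P p I θ e N n ω where
  good := hg
  M_pos := hM
  norm_le := hψ
  length_le _ hD := hn _ (hD.pow_length_le hlam heps)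
  greedy h l st hl hst hN hcov := POMDP.qStar_eq_vStar_of_abs_sub_lt (hgap h _)
    (fun a => (hg.abs_thetaHat_dotProduct_featEst_sub_le hlam heps he hl hst hN
      (hn _ ((hst.uncovered h).pow_length_le hlam heps)) hcov (hθ h a)).trans_lt hΔ)
    (hamax fun a => thetaHat I.lam (st.data h) a ⬝ᵥ featEst I ω h l st.episodes)

end Greedy

/-! ## Linear futures and admissible parameters -/

section Admissible

/-- `K`-step observability in the form used by the algorithm: at every step, for some sequence `b`
of `k = K - 1` actions, the optimal `Q`-values are linear functionals, of norm at most `Θ`, of the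
mean future feature under `b`. -/
def HasLinearFutureQ {S O : Type*} [MeasurableSpace S] [MeasurableSpace O] {A k d : ℕ}
    (P : POMDP S O A) (p : ℕ → S → Fin A → S) (H : ℕ)
    (ψ : (Fin (k + 1) → O) → EuclideanSpace ℝ (Fin d)) (Θ : ℝ) : Prop :=
  ∀ h : Fin H, ∃ b : Fin k → Fin A, ∀ a : Fin A, ∃ θ : EuclideanSpace ℝ (Fin d),
    ‖θ‖ ≤ Θ ∧ ∀ s, P.qStar p H h s a = inner ℝ θ (∫ o, ψ o ∂(P.window k h b s))

variable {S O : Type*} [MeasurableSpace S] [MeasurableSpace O] {H k A d : ℕ} {P : POMDP S O A}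
  {p : ℕ → S → Fin A → S}

theorem smallestSingularValue_mul_norm_le {ds : ℕ} {G : Matrix (Fin d) (Fin ds) ℝ}
    {L : Matrix (Fin ds) (Fin d) ℝ} (hL : L * G = 1) (x : EuclideanSpace ℝ (Fin ds)) :
    smallestSingularValue G * ‖x‖ ≤ ‖Matrix.toEuclideanLin G x‖ := by
  have hle : ds ≤ d := by
    have hrank := (Matrix.rank_mul_le_right L G).trans (Matrix.rank_le_height G)
    rwa [hL, Matrix.rank_one, Fintype.card_fin] at hrank
  rw [smallestSingularValue, min_eq_right hle]
  simpa only [finrank_euclideanSpace_fin] using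
    singularValues_mul_norm_le (Matrix.toEuclideanLin G) x

theorem iInf_smallestSingularValue_pos {ds : ℕ} {G : Fin H → Matrix (Fin d) (Fin ds) ℝ}
    {W : ℝ} (hW : 1 ≤ W / ⨅ h, smallestSingularValue (G h)) :
    0 < ⨅ h, smallestSingularValue (G h) := by
  refine lt_of_le_of_ne (Real.iInf_nonneg fun h => LinearMap.singularValues_nonneg _ _) fun h0 => ?_
  rw [← h0, div_zero] at hW
  exact absurd hW (by norm_num)

theorem HasLinearFutureQ.of_embedding {ds : ℕ} {φ : S → EuclideanSpace ℝ (Fin ds)}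
    {ψ : (Fin (k + 1) → O) → EuclideanSpace ℝ (Fin d)} {G : Fin H → Matrix (Fin d) (Fin ds) ℝ}
    {W : ℝ} (hpos : 0 < ⨅ h, smallestSingularValue (G h))
    (hlin : ∀ (h : Fin H) (a : Fin A), ∃ w : EuclideanSpace ℝ (Fin ds),
      ‖w‖ ≤ W ∧ ∀ s, P.qStar p H h s a = inner ℝ w (φ s))
    (hG : ∀ h : Fin H, (∃ L : Matrix (Fin ds) (Fin d) ℝ, L * G h = 1) ∧
      ∃ b : Fin k → Fin A, ∀ s,
        ∫ o, ψ o ∂(P.window k h b s) = Matrix.toEuclideanLin (G h) (φ s)) :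
    HasLinearFutureQ P p H ψ (W / ⨅ h, smallestSingularValue (G h)) := by
  intro h
  obtain ⟨⟨L, hL⟩, b, hb⟩ := hG h
  refine ⟨b, fun a => ?_⟩
  obtain ⟨w, hw, hq⟩ := hlin h a
  obtain ⟨θ, hθ, hinner⟩ := exists_inner_map_eq hpos (fun x => (mul_le_mul_of_nonneg_right
    (ciInf_le (Set.finite_range _).bddBelow h) (norm_nonneg x)).trans
      (smallestSingularValue_mul_norm_le hL x)) w
  exact ⟨θ, hθ.trans (by gcongr), fun s => by rw [hq, hb, hinner]⟩

/-- Parameters `lam`, `eps`, `M` of the algorithm that make it succeed with at most `N` episodes,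
except with probability `δ`: the data sets have at most `n` entries, estimates of accuracy `e`
determine the optimal actions, and it fails to reach this accuracy with probability at most `δ`. -/
structure Admissible (H k d A : ℕ) (Θ Δ δ lam eps e : ℝ) (M n N : ℕ) : Prop where
  lam_pos : 0 < lam
  eps_nonneg : 0 ≤ eps
  accuracy_nonneg : 0 ≤ e
  M_pos : 0 < M
  length_le : ∀ m : ℕ, (1 + eps ^ 2) ^ m ≤ (1 + m * (A : ℝ) ^ k / lam) ^ (A ^ k * d) → m ≤ n
  error_lt : eps * (√n * (2 * e) + √lam * Θ) + e < Δ / 2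
  episodes_le : H * n * ((A + 1) * (H * (M * (A ^ k + A)))) + H * (M * (A ^ k + A)) ≤ N
  tail_le : H * A * A ^ H * N * (2 * Real.exp (-(e ^ 2 * M) / (2 * Θ ^ 2)))
    + H * A ^ H * N ^ H * (2 * Real.exp (-(2 * e ^ 2 * M) / H)) ≤ δ

theorem Admissible.tapeLaw_le [NeZero A] {Θ Δ δ lam eps e : ℝ} {M n N : ℕ}
    (hadm : Admissible H k d A Θ Δ δ lam eps e M n N) (hp : P.IsDeterministic p)
    {ψ : (Fin (k + 1) → O) → EuclideanSpace ℝ (Fin d)} (hlin : HasLinearFutureQ P p H ψ Θ)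
    (hgap : ∀ (h : Fin H) (s : S) (a : Fin A), 0 < P.gap p H h s a → Δ ≤ P.gap p H h s a)
    (hψm : Measurable ψ) (hψ : ∀ o, ‖ψ o‖ ≤ 1) {amax : (Fin A → ℝ) → Fin A}
    (hamax : ∀ (f : Fin A → ℝ) (a : Fin A), f a ≤ f (amax f)) :
    tapeLaw P H k {ω | ¬ ∃ l N', Outputs ⟨lam, eps, M, ψ, amax⟩ ω l N' ∧
      P.IsOptimalActions H l ∧ N' ≤ N * (H + k)} ≤ ENNReal.ofReal δ := by
  choose b θ hθ hq using hlin
  have hgood := (tapeLaw_not_goodTape_le (I := ⟨lam, eps, M, ψ, amax⟩) hp hadm.M_pos hψm hψ hθ hq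
    N hadm.accuracy_nonneg).trans hadm.tail_le
  rw [← ofReal_measureReal]
  refine ENNReal.ofReal_le_ofReal ((measureReal_mono fun ω => mt fun hω => ?_).trans hgood)
  refine exists_outputs (hω.favorable hadm.M_pos hψ hadm.lam_pos hadm.eps_nonneg
    hadm.accuracy_nonneg hamax (fun h a => ?_) hgap hadm.length_le hadm.error_lt) hp
      hadm.episodes_le
  rw [blockVec_dotProduct_self, Real.sqrt_sq (norm_nonneg _)]
  exact hθ h a

end Admissible

/-! ## Choice of the parameters -/

theorem le_of_two_pow_le {m D : ℕ} {X Y : ℝ} (hD : 0 < D) (hX : Real.exp 1 ≤ X) (hY : 0 ≤ Y)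
    (hYX : D * Y ≤ 64 * X ^ 6) (h : (2 : ℝ) ^ m ≤ (1 + m * Y) ^ D) :
    (m : ℝ) ≤ 28 * D * Real.log X := by
  have hX1 : 1 ≤ X := (Real.one_le_exp zero_le_one).trans hX
  have hL : 1 ≤ Real.log X := (Real.le_log_iff_exp_le (by linarith)).2 hX
  have hD' : (0 : ℝ) < D := Nat.cast_pos.2 hD
  obtain ⟨y, hy, hm⟩ : ∃ y : ℝ, 0 ≤ y ∧ (m : ℝ) = D * y :=
    ⟨m / D, by positivity, (mul_div_cancel₀ _ hD'.ne').symm⟩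
  have hbase : 1 + m * Y ≤ 256 * X ^ 6 * ((1 + y) / 4) := by
    rw [hm]
    nlinarith [one_le_pow₀ (n := 6) hX1]
  have hlogbase : Real.log (1 + m * Y) ≤ 8 * Real.log 2 + 6 * Real.log X + y / 4 := by
    refine (Real.log_le_log (by positivity) hbase).trans ?_
    rw [Real.log_mul (by positivity) (by positivity), Real.log_mul (by norm_num) (by positivity),
      Real.log_pow, show (256 : ℝ) = 2 ^ 8 by norm_num, Real.log_pow]
    have := Real.log_le_sub_one_of_pos (show 0 < (1 + y) / 4 by positivity)
    push_cast
    linarith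
  have hlog : y * Real.log 2 ≤ 8 * Real.log 2 + 6 * Real.log X + y / 4 := by
    have := Real.log_le_log (by positivity) h
    rw [Real.log_pow, Real.log_pow, hm, mul_assoc, ← hm] at this
    exact (le_of_mul_le_mul_left this hD').trans hlogbase
  rw [hm, mul_comm 28, mul_assoc]
  gcongr
  nlinarith [Real.log_two_gt_d9, Real.log_two_lt_d9]

theorem mul_two_mul_exp_neg_le {Y q δ : ℝ} (hY : 0 < Y) (hδ : 0 < δ)
    (hq : Real.log 4 + Real.log Y + Real.log (1 / δ) ≤ q) : Y * (2 * Real.exp (-q)) ≤ δ / 2 := by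
  have hexp : Real.exp (-q) ≤ δ / (4 * Y) := by
    rw [← Real.le_log_iff_exp_le (by positivity), Real.log_div hδ.ne' (by positivity),
      Real.log_mul (by norm_num) hY.ne']
    rw [one_div, Real.log_inv] at hq
    linarith
  calc Y * (2 * Real.exp (-q)) ≤ Y * (2 * (δ / (4 * Y))) := by gcongr
    _ = δ / 2 := by field_simp; norm_num

/-- The numbers on which the parameters of the algorithm may depend, with `k = K - 1`. -/
structure Regime where
  H : ℕ
  k : ℕ
  d : ℕ
  A : ℕ
  Θ : ℝ
  Δ : ℝ
  δ : ℝ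
  one_le_H : 1 ≤ H
  one_le_d : 1 ≤ d
  two_le_A : 2 ≤ A
  one_le_Θ : 1 ≤ Θ
  Δ_pos : 0 < Δ
  Δ_le_Θ : Δ ≤ Θ
  δ_pos : 0 < δ
  δ_le_half : δ ≤ 1 / 2

namespace Regime

variable (R : Regime)

/-- The logarithmic confidence factor. -/
noncomputable def confidence : ℝ := Real.log (1 / R.δ)

/-- The argument of the logarithm in the sample bound. -/
noncomputable def size : ℝ := 2 + R.H + R.d * R.A ^ (R.k + 1) + R.Θ + 1 / R.Δ + R.confidence

/-- The logarithmic factor of the sample bound. -/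
noncomputable def logSize : ℝ := Real.log R.size

/-- The dimension of the stacked features. -/
noncomputable def dim : ℝ := R.A ^ R.k * R.d

/-- The regularization parameter `λ`, so small that the bias of ridge regression is at most
`Δ / 8`. -/
noncomputable def regularizer : ℝ := (R.Δ / (8 * R.Θ)) ^ 2

/-- The bound on the number of entries of a data set that the elliptical potential gives for
`ε = 1`. -/
noncomputable def dataBound : ℝ := 28 * R.dim * R.logSize

/-- The integral part of `dataBound`. -/
noncomputable def maxData : ℕ := ⌊R.dataBound⌋₊

/-- The accuracy of the estimates, so small that it contributes at most `Δ / 8` to the error of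
ridge regression on a data set of `dataBound` entries. -/
noncomputable def accuracy : ℝ := R.Δ / (16 * √R.dataBound)

/-- The order of magnitude of the number of episodes per estimate. -/
noncomputable def batchScale : ℝ :=
  R.dim * R.H ^ 2 * (R.Θ / R.Δ) ^ 2 * R.logSize ^ 2 * R.confidence

/-- The number `M` of episodes per estimate. -/
noncomputable def batch : ℕ := ⌈2 ^ 22 * R.batchScale⌉₊

/-- The bound on the number of episodes. -/
noncomputable def maxEpisodes : ℕ :=
  R.H * R.maxData * ((R.A + 1) * (R.H * (R.batch * (R.A ^ R.k + R.A))))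
    + R.H * (R.batch * (R.A ^ R.k + R.A))

theorem one_le_cast_H : (1 : ℝ) ≤ R.H := by exact_mod_cast R.one_le_H

theorem one_le_cast_d : (1 : ℝ) ≤ R.d := by exact_mod_cast R.one_le_d

theorem two_le_cast_A : (2 : ℝ) ≤ R.A := by exact_mod_cast R.two_le_A

theorem one_le_cast_A : (1 : ℝ) ≤ R.A := one_le_two.trans R.two_le_cast_A

theorem Θ_pos : 0 < R.Θ := zero_lt_one.trans_le R.one_le_Θ

theorem one_le_Θ_div_Δ : 1 ≤ R.Θ / R.Δ := (one_le_div R.Δ_pos).2 R.Δ_le_Θ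

theorem half_le_confidence : 1 / 2 ≤ R.confidence := by
  have hδ : 2 ≤ 1 / R.δ := by
    rw [le_div_iff₀ R.δ_pos]
    linarith [R.δ_le_half]
  unfold confidence
  linarith [Real.log_le_log two_pos hδ, Real.log_two_gt_d9]

theorem confidence_pos : 0 < R.confidence := by linarith [R.half_le_confidence]

theorem two_le_d_mul_A_pow : (2 : ℝ) ≤ R.d * R.A ^ (R.k + 1) :=
  calc (2 : ℝ) ≤ R.A ^ (R.k + 1) :=
        R.two_le_cast_A.trans (le_self_pow₀ R.one_le_cast_A (Nat.succ_ne_zero _))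
    _ ≤ R.d * R.A ^ (R.k + 1) := le_mul_of_one_le_left (by positivity) R.one_le_cast_d

theorem one_div_Δ_pos : 0 < 1 / R.Δ := one_div_pos.2 R.Δ_pos

theorem H_le_size : (R.H : ℝ) ≤ R.size := by
  unfold size
  linarith [R.two_le_d_mul_A_pow, R.Θ_pos, R.one_div_Δ_pos, R.confidence_pos]

theorem d_mul_A_pow_le_size : (R.d : ℝ) * R.A ^ (R.k + 1) ≤ R.size := by
  unfold size
  linarith [R.one_le_cast_H, R.Θ_pos, R.one_div_Δ_pos, R.confidence_pos]

theorem Θ_le_size : R.Θ ≤ R.size := by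
  unfold size
  linarith [R.one_le_cast_H, R.two_le_d_mul_A_pow, R.one_div_Δ_pos, R.confidence_pos]

theorem one_div_Δ_le_size : 1 / R.Δ ≤ R.size := by
  unfold size
  linarith [R.one_le_cast_H, R.two_le_d_mul_A_pow, R.Θ_pos, R.confidence_pos]

theorem confidence_le_size : R.confidence ≤ R.size := by
  unfold size
  linarith [R.one_le_cast_H, R.two_le_d_mul_A_pow, R.Θ_pos, R.one_div_Δ_pos]

theorem exp_one_le_size : Real.exp 1 ≤ R.size := by
  unfold size
  linarith [Real.exp_one_lt_d9, R.one_le_cast_H, R.two_le_d_mul_A_pow, R.Θ_pos, R.one_div_Δ_pos,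
    R.confidence_pos]

theorem size_pos : 0 < R.size := (Real.exp_pos 1).trans_le R.exp_one_le_size

theorem A_pow_le_size {i : ℕ} (hi : i ≤ R.k + 1) : (R.A : ℝ) ^ i ≤ R.size :=
  (pow_le_pow_right₀ R.one_le_cast_A hi).trans
    ((le_mul_of_one_le_left (by positivity) R.one_le_cast_d).trans R.d_mul_A_pow_le_size)

theorem A_le_size : (R.A : ℝ) ≤ R.size := by
  simpa only [pow_one] using R.A_pow_le_size (Nat.le_add_left 1 R.k)

theorem one_le_logSize : 1 ≤ R.logSize :=
  (Real.le_log_iff_exp_le R.size_pos).2 R.exp_one_le_size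

theorem logSize_pos : 0 < R.logSize := zero_lt_one.trans_le R.one_le_logSize

theorem logSize_le_size : R.logSize ≤ R.size := Real.log_le_self R.size_pos.le

theorem one_le_dim : 1 ≤ R.dim :=
  one_le_mul_of_one_le_of_one_le (one_le_pow₀ R.one_le_cast_A) R.one_le_cast_d

theorem dim_pos : 0 < R.dim := zero_lt_one.trans_le R.one_le_dim

theorem dim_le_size : R.dim ≤ R.size := by
  refine le_trans ?_ R.d_mul_A_pow_le_size
  rw [dim, mul_comm]
  gcongr
  exacts [R.one_le_cast_A, Nat.le_succ _]

theorem one_le_dataBound : 1 ≤ R.dataBound :=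
  one_le_mul_of_one_le_of_one_le (by linarith [R.one_le_dim]) R.one_le_logSize

theorem maxData_le : (R.maxData : ℝ) ≤ R.dataBound :=
  Nat.floor_le (zero_le_one.trans R.one_le_dataBound)

theorem regularizer_pos : 0 < R.regularizer := by
  have := R.Θ_pos
  have := R.Δ_pos
  unfold regularizer
  positivity

theorem accuracy_pos : 0 < R.accuracy :=
  div_pos R.Δ_pos (mul_pos (by norm_num) (Real.sqrt_pos.2 (zero_lt_one.trans_le
    R.one_le_dataBound)))

theorem le_maxData {m : ℕ} (hm : (1 + 1 ^ 2 : ℝ) ^ m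
    ≤ (1 + m * (R.A : ℝ) ^ R.k / R.regularizer) ^ (R.A ^ R.k * R.d)) : m ≤ R.maxData := by
  have hD : ((R.A ^ R.k * R.d : ℕ) : ℝ) = R.dim := by rw [dim]; push_cast; rfl
  have hX := R.size_pos
  have hΔ := R.Δ_pos
  have hΘ := R.Θ_pos
  have hreg : R.dim * ((R.A : ℝ) ^ R.k / R.regularizer) ≤ 64 * R.size ^ 6 :=
    calc R.dim * ((R.A : ℝ) ^ R.k / R.regularizer)
        = 64 * (R.dim * R.A ^ R.k * R.Θ ^ 2 * (1 / R.Δ) ^ 2) := by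
          unfold regularizer; field_simp; norm_num
      _ ≤ 64 * (R.size * R.size * R.size ^ 2 * R.size ^ 2) := by
          gcongr
          exacts [R.dim_le_size, R.A_pow_le_size (Nat.le_succ _), R.Θ_le_size, R.one_div_Δ_le_size]
      _ = 64 * R.size ^ 6 := by ring
  rw [one_pow, one_add_one_eq_two, mul_div_assoc] at hm
  have hle := le_of_two_pow_le (Nat.cast_pos.1 (hD ▸ R.dim_pos)) R.exp_one_le_size
    (div_nonneg (by positivity) R.regularizer_pos.le) (hD ▸ hreg) hm
  rw [hD] at hle
  exact Nat.le_floor hle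

theorem prediction_error_lt :
    1 * (√R.maxData * (2 * R.accuracy) + √R.regularizer * R.Θ) + R.accuracy < R.Δ / 2 := by
  have hΔ := R.Δ_pos
  have hΘ := R.Θ_pos
  have hB : 1 ≤ √R.dataBound := Real.one_le_sqrt.2 R.one_le_dataBound
  have hnoise : √R.maxData * (2 * R.accuracy) ≤ R.Δ / 8 :=
    calc √R.maxData * (2 * R.accuracy) ≤ √R.dataBound * (2 * R.accuracy) :=
          mul_le_mul_of_nonneg_right (Real.sqrt_le_sqrt R.maxData_le)
            (mul_nonneg zero_le_two R.accuracy_pos.le)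
      _ = R.Δ / 8 := by unfold accuracy; field_simp; norm_num
  have hbias : √R.regularizer * R.Θ = R.Δ / 8 := by
    rw [regularizer, Real.sqrt_sq (by positivity)]
    field_simp
  have hacc : R.accuracy ≤ R.Δ / 16 := by
    unfold accuracy
    gcongr
    linarith
  linarith

theorem half_le_batchScale : 1 / 2 ≤ R.batchScale :=
  R.half_le_confidence.trans (le_mul_of_one_le_left R.confidence_pos.le
    (one_le_mul_of_one_le_of_one_le (one_le_mul_of_one_le_of_one_le
      (one_le_mul_of_one_le_of_one_le R.one_le_dim (one_le_pow₀ R.one_le_cast_H))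
      (one_le_pow₀ R.one_le_Θ_div_Δ)) (one_le_pow₀ R.one_le_logSize)))

theorem batch_ge : 2 ^ 22 * R.batchScale ≤ R.batch := Nat.le_ceil _

theorem batch_le : R.batch ≤ 2 ^ 23 * R.batchScale := by
  have hm := R.half_le_batchScale
  have := Nat.ceil_lt_add_one (show 0 ≤ 2 ^ 22 * R.batchScale by positivity)
  rw [batch]
  linarith

theorem batch_pos : 0 < R.batch :=
  Nat.ceil_pos.2 (mul_pos (by norm_num) (by linarith [R.half_le_batchScale]))

theorem one_le_maxEpisodes : 1 ≤ R.maxEpisodes :=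
  le_add_left (Nat.mul_pos R.one_le_H (Nat.mul_pos R.batch_pos
    (Nat.add_pos_right _ (Nat.lt_of_lt_of_le two_pos R.two_le_A))))

theorem maxEpisodes_le : (R.maxEpisodes : ℝ)
    ≤ 2 ^ 30 * (R.H ^ 2 * R.dim * R.logSize * R.batchScale * R.A ^ (R.k + 2)) := by
  have hH := R.one_le_cast_H
  have hA := R.two_le_cast_A
  have hAk : (1 : ℝ) ≤ (R.A : ℝ) ^ R.k := one_le_pow₀ R.one_le_cast_A
  have hB := R.one_le_dataBound
  have hlevel : (R.A : ℝ) ^ R.k + R.A ≤ 2 * R.A ^ (R.k + 1) := by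
    rw [pow_succ]
    nlinarith
  have hentries : (R.H : ℝ) * R.maxData * (R.A + 1) + 1 ≤ 2 * R.A * (R.H * R.dataBound) := by
    have : (R.H : ℝ) * R.maxData ≤ R.H * R.dataBound := by gcongr; exact R.maxData_le
    nlinarith [one_le_mul_of_one_le_of_one_le hH hB]
  have hm := one_half_pos.trans_le R.half_le_batchScale
  have hD := R.dim_pos
  have hL := R.logSize_pos
  calc (R.maxEpisodes : ℝ)
      = (R.H * R.maxData * (R.A + 1) + 1) * (R.H * R.batch * (R.A ^ R.k + R.A)) := by
        rw [maxEpisodes]; push_cast; ring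
    _ ≤ (2 * R.A * (R.H * R.dataBound)) *
          (R.H * (2 ^ 23 * R.batchScale) * (2 * R.A ^ (R.k + 1))) := by
        gcongr; exact R.batch_le
    _ = 112 * 2 ^ 23 *
          (R.H ^ 2 * R.dim * R.logSize * R.batchScale * R.A ^ (R.k + 2)) := by
        rw [dataBound]; ring
    _ ≤ _ := by gcongr; norm_num

theorem maxEpisodes_le_size_pow : (R.maxEpisodes : ℝ) ≤ 2 ^ 30 * R.size ^ 16 := by
  have hX := R.size_pos
  have hL := R.logSize_pos
  have hD := R.dim_pos
  have hℓ := R.confidence_pos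
  have hΔ := R.one_div_Δ_pos
  have hratio : R.Θ / R.Δ ≤ R.size * R.size := by
    rw [← mul_one_div]
    gcongr
    exacts [R.Θ_le_size, R.one_div_Δ_le_size]
  have hbatch : R.batchScale
      ≤ R.size * R.size ^ 2 * (R.size * R.size) ^ 2 * R.size ^ 2 * R.size := by
    have := zero_le_one.trans R.one_le_Θ_div_Δ
    unfold batchScale
    gcongr
    exacts [R.dim_le_size, R.H_le_size, R.logSize_le_size, R.confidence_le_size]
  calc (R.maxEpisodes : ℝ)
      ≤ 2 ^ 30 * (R.H ^ 2 * R.dim * R.logSize * R.batchScale * (R.A ^ (R.k + 1) * R.A)) :=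
        R.maxEpisodes_le
    _ ≤ 2 ^ 30 * (R.size ^ 2 * R.size * R.size *
          (R.size * R.size ^ 2 * (R.size * R.size) ^ 2 * R.size ^ 2 * R.size) *
          (R.size * R.size)) := by
        have := one_half_pos.trans_le R.half_le_batchScale
        gcongr
        exacts [R.H_le_size, R.dim_le_size, R.logSize_le_size, R.A_pow_le_size le_rfl, R.A_le_size]
    _ = 2 ^ 30 * R.size ^ 16 := by ring

theorem log_maxEpisodes_le : Real.log R.maxEpisodes ≤ 37 * R.logSize := by
  have hN : (0 : ℝ) < R.maxEpisodes := Nat.cast_pos.2 R.one_le_maxEpisodes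
  refine (Real.log_le_log hN R.maxEpisodes_le_size_pow).trans ?_
  rw [Real.log_mul (by norm_num) (pow_pos R.size_pos _).ne', Real.log_pow, Real.log_pow,
    ← logSize]
  push_cast
  linarith [Real.log_two_lt_d9, R.one_le_logSize]

/-- A bound for the number of events in the two tail bounds. -/
noncomputable def eventCount : ℝ := R.H * R.A * R.A ^ R.H * R.maxEpisodes ^ R.H

theorem eventCount_pos : 0 < R.eventCount := by
  have hH := zero_lt_one.trans_le R.one_le_cast_H
  have hA := zero_lt_one.trans_le R.one_le_cast_A
  have hN : (0 : ℝ) < R.maxEpisodes := Nat.cast_pos.2 R.one_le_maxEpisodes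
  unfold eventCount
  positivity

theorem log_eventCount_le : Real.log R.eventCount ≤ 40 * (R.H * R.logSize) := by
  have hH := zero_lt_one.trans_le R.one_le_cast_H
  have hA := zero_lt_one.trans_le R.one_le_cast_A
  have hN : (0 : ℝ) < R.maxEpisodes := Nat.cast_pos.2 R.one_le_maxEpisodes
  have hlogH : Real.log R.H ≤ R.logSize := Real.log_le_log hH R.H_le_size
  have hlogA : Real.log R.A ≤ R.logSize := Real.log_le_log hA R.A_le_size
  have hHA : R.H * Real.log R.A ≤ R.H * R.logSize := by gcongr
  have hHN : R.H * Real.log R.maxEpisodes ≤ R.H * (37 * R.logSize) := by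
    gcongr
    exact R.log_maxEpisodes_le
  have hL : R.logSize ≤ R.H * R.logSize := le_mul_of_one_le_left R.logSize_pos.le R.one_le_cast_H
  rw [eventCount, Real.log_mul (by positivity) (by positivity),
    Real.log_mul (by positivity) (by positivity), Real.log_mul (by positivity) (by positivity),
    Real.log_pow, Real.log_pow]
  linarith

/-- A common lower bound for the exponents in the two tail bounds. -/
noncomputable def exponent : ℝ := R.accuracy ^ 2 * R.batch / (2 * R.Θ ^ 2 * R.H)

theorem le_exponent : 292 * (R.H * R.logSize * R.confidence) ≤ R.exponent := by
  have hH := zero_lt_one.trans_le R.one_le_cast_H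
  have hL := R.logSize_pos
  have hD := R.dim_pos
  have hℓ := R.confidence_pos
  have hΘ := R.Θ_pos
  have hΔ := R.Δ_pos
  have hacc : R.accuracy ^ 2 = R.Δ ^ 2 / (16 ^ 2 * (28 * R.dim * R.logSize)) := by
    rw [accuracy, div_pow, mul_pow, Real.sq_sqrt (zero_le_one.trans R.one_le_dataBound), dataBound]
  calc 292 * (R.H * R.logSize * R.confidence)
      ≤ (2 ^ 22 / 14336) * (R.H * R.logSize * R.confidence) := by gcongr; norm_num
    _ = R.accuracy ^ 2 * (2 ^ 22 * R.batchScale) / (2 * R.Θ ^ 2 * R.H) := by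
        rw [hacc, batchScale]; field_simp; norm_num
    _ ≤ R.exponent := by unfold exponent; gcongr; exact R.batch_ge

theorem log_four_add_le_exponent :
    Real.log 4 + Real.log R.eventCount + R.confidence ≤ R.exponent := by
  have hlog4 : Real.log 4 ≤ 2 := by
    rw [show (4 : ℝ) = 2 ^ 2 by norm_num, Real.log_pow]
    push_cast
    linarith [Real.log_two_lt_d9]
  have hHL : 1 ≤ R.H * R.logSize := one_le_mul_of_one_le_of_one_le R.one_le_cast_H R.one_le_logSize
  nlinarith [R.log_eventCount_le, R.le_exponent, R.half_le_confidence]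

theorem eventCount_mul_exp_le : R.eventCount * (2 * Real.exp (-R.exponent)) ≤ R.δ / 2 :=
  mul_two_mul_exp_neg_le R.eventCount_pos R.δ_pos R.log_four_add_le_exponent

theorem feature_tail_le : R.H * R.A * R.A ^ R.H * R.maxEpisodes *
    (2 * Real.exp (-(R.accuracy ^ 2 * R.batch) / (2 * R.Θ ^ 2))) ≤ R.δ / 2 := by
  have hΘ := R.Θ_pos
  have hexp : R.exponent ≤ R.accuracy ^ 2 * R.batch / (2 * R.Θ ^ 2) :=
    div_le_div_of_nonneg_left (by positivity) (by positivity)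
      (le_mul_of_one_le_right (by positivity) R.one_le_cast_H)
  refine le_trans ?_ R.eventCount_mul_exp_le
  unfold eventCount
  rw [neg_div]
  gcongr
  exact le_self_pow₀ (Nat.one_le_cast.2 R.one_le_maxEpisodes)
    (Nat.one_le_iff_ne_zero.1 R.one_le_H)

theorem reward_tail_le : R.H * R.A ^ R.H * R.maxEpisodes ^ R.H *
    (2 * Real.exp (-(2 * R.accuracy ^ 2 * R.batch) / R.H)) ≤ R.δ / 2 := by
  have hH := zero_lt_one.trans_le R.one_le_cast_H
  have hΘ := R.Θ_pos
  have hexp : R.exponent ≤ 2 * R.accuracy ^ 2 * R.batch / R.H := by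
    rw [exponent, div_le_div_iff₀ (by positivity) hH]
    calc R.accuracy ^ 2 * R.batch * R.H
        ≤ R.accuracy ^ 2 * R.batch * R.H * (4 * R.Θ ^ 2) := by
          refine le_mul_of_one_le_right (by positivity) ?_
          nlinarith [R.one_le_Θ]
      _ = 2 * R.accuracy ^ 2 * R.batch * (2 * R.Θ ^ 2 * R.H) := by ring
  refine le_trans ?_ R.eventCount_mul_exp_le
  unfold eventCount
  rw [neg_div]
  gcongr
  exact le_mul_of_one_le_right hH.le R.one_le_cast_A

theorem admissible : Admissible R.H R.k R.d R.A R.Θ R.Δ R.δ R.regularizer 1 R.accuracy R.batch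
    R.maxData R.maxEpisodes where
  lam_pos := R.regularizer_pos
  eps_nonneg := zero_le_one
  accuracy_nonneg := R.accuracy_pos.le
  M_pos := R.batch_pos
  length_le _ := R.le_maxData
  error_lt := R.prediction_error_lt
  episodes_le := le_rfl
  tail_le := (add_le_add R.feature_tail_le R.reward_tail_le).trans_eq (add_halves _)

theorem H_add_k_le : (R.H : ℝ) + R.k ≤ R.H * (2 * R.logSize) := by
  have hk : (R.k + 1) * Real.log 2 ≤ R.logSize := by
    have h2 : (2 : ℝ) ^ (R.k + 1) ≤ R.size :=
      (pow_le_pow_left₀ zero_le_two R.two_le_cast_A _).trans (R.A_pow_le_size le_rfl)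
    simpa [logSize] using Real.log_le_log (by positivity) h2
  have hk' : (R.k + 1 : ℝ) * (1 / 2) ≤ (R.k + 1) * Real.log 2 := by
    gcongr
    linarith [Real.log_two_gt_d9]
  calc (R.H : ℝ) + R.k ≤ R.H + R.H * R.k := by
        gcongr
        exact le_mul_of_one_le_left (Nat.cast_nonneg _) R.one_le_cast_H
    _ = R.H * (R.k + 1) := by ring
    _ ≤ R.H * (2 * R.logSize) := by gcongr; linarith

theorem maxEpisodes_mul_le : (R.maxEpisodes : ℝ) * (R.H + R.k) ≤ 2 ^ 31 * R.logSize ^ 4 *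
    (R.H ^ 5 * R.A ^ (3 * R.k + 2) * R.d ^ 2 * (R.Θ / R.Δ) ^ 2 * R.confidence) := by
  have hL := R.logSize_pos
  calc (R.maxEpisodes : ℝ) * (R.H + R.k) ≤ R.maxEpisodes * (R.H * (2 * R.logSize)) := by
        gcongr; exact R.H_add_k_le
    _ ≤ 2 ^ 30 * (R.H ^ 2 * R.dim * R.logSize * R.batchScale * R.A ^ (R.k + 2)) *
          (R.H * (2 * R.logSize)) := by gcongr; exact R.maxEpisodes_le
    _ = _ := by
        rw [batchScale, dim, show 3 * R.k + 2 = R.k + R.k + (R.k + 2) by ring,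
          pow_add _ (R.k + R.k), pow_add _ R.k R.k]
        ring

theorem rate_le : 2 ^ 31 * R.logSize ^ 4 *
      (R.H ^ 5 * R.A ^ (3 * R.k + 2) * R.d ^ 2 * (R.Θ / R.Δ) ^ 2 * R.confidence) ≤
    2 ^ 31 * R.logSize ^ 4 *
      (R.H ^ 5 * R.Θ ^ 5 * R.A ^ (3 * (R.k + 1) - 1) * R.d ^ 2 * (1 / R.Δ) ^ 5 *
        R.confidence) := by
  have hℓ := R.confidence_pos
  have hL := R.logSize_pos
  have hratio : (R.Θ / R.Δ) ^ 2 ≤ (R.Θ / R.Δ) ^ 5 :=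
    pow_le_pow_right₀ R.one_le_Θ_div_Δ (by norm_num)
  calc _ ≤ 2 ^ 31 * R.logSize ^ 4 *
        (R.H ^ 5 * R.A ^ (3 * R.k + 2) * R.d ^ 2 * (R.Θ / R.Δ) ^ 5 * R.confidence) := by gcongr
    _ = _ := by
        rw [show 3 * (R.k + 1) - 1 = 3 * R.k + 2 by omega, ← mul_one_div R.Θ, mul_pow]
        ring

end Regime

end HSEPOMDP

theorem mainTheorem4_general :
    ∀ (H k d A : ℕ) [NeZero A] (Θ Δ δ : ℝ),
      1 ≤ H → 1 ≤ d → 2 ≤ A → 1 ≤ Θ → 0 < Δ → Δ ≤ Θ → 0 < δ → δ ≤ 1 / 2 →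
    ∃ (lam ε : ℝ) (M : ℕ), 0 < lam ∧ 0 < ε ∧ 1 ≤ M ∧
    ∀ {S O : Type*} [MeasurableSpace S] [MeasurableSpace O] (P : HSEPOMDP.POMDP S O A)
      (p : ℕ → S → Fin A → S) (ψ : (Fin (k + 1) → O) → EuclideanSpace ℝ (Fin d))
      (amax : (Fin A → ℝ) → Fin A),
      P.IsDeterministic p →
      HSEPOMDP.HasLinearFutureQ P p H ψ Θ →
      (∀ (h : Fin H) (s : S) (a : Fin A), 0 < P.gap p H h s a → Δ ≤ P.gap p H h s a) →
      Measurable ψ → (∀ o, ‖ψ o‖ ≤ 1) →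
      (∀ (f : Fin A → ℝ) (a : Fin A), f a ≤ f (amax f)) →
      HSEPOMDP.tapeLaw P H k
        {ω | ¬ ∃ (l : List (Fin A)) (N : ℕ),
          HSEPOMDP.Outputs ⟨lam, ε, M, ψ, amax⟩ ω l N ∧
          P.IsOptimalActions H l ∧
          (N : ℝ) ≤ 2 ^ 31 *
            Real.log (2 + H + d * A ^ (k + 1) + Θ + 1 / Δ + Real.log (1 / δ)) ^ 4 *
            (H ^ 5 * A ^ (3 * k + 2) * d ^ 2 * (Θ / Δ) ^ 2 * Real.log (1 / δ))}
        ≤ ENNReal.ofReal δ := by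
  intro H k d A _ Θ Δ δ hH hd hA hΘ hΔ hΔΘ hδ hδ2
  let R : HSEPOMDP.Regime := ⟨H, k, d, A, Θ, Δ, δ, hH, hd, hA, hΘ, hΔ, hΔΘ, hδ, hδ2⟩
  refine ⟨R.regularizer, 1, R.batch, R.regularizer_pos, one_pos, R.batch_pos, ?_⟩
  intro S O _ _ P p ψ amax hp hlin hgap hψm hψ hamax
  refine (measure_mono fun ω => mt ?_).trans
    (R.admissible.tapeLaw_le hp hlin hgap hψm hψ hamax)
  rintro ⟨l, N, hrun, hopt, hN⟩
  refine ⟨l, N, hrun, hopt, le_trans ?_ R.maxEpisodes_mul_le⟩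
  exact_mod_cast hN

theorem mainTheorem4 :
    ∃ (C : ℝ) (q : ℕ), 0 < C ∧
    -- the future length is `K = k + 1`
    ∀ (H k d A : ℕ) [NeZero A] (Θ Δ δ : ℝ),
      1 ≤ H → 1 ≤ d → 2 ≤ A → 1 ≤ Θ → 0 < Δ → Δ ≤ Θ → 0 < δ → δ ≤ 1 / 2 →
    ∃ (lam ε : ℝ) (M : ℕ), 0 < lam ∧ 0 < ε ∧ 1 ≤ M ∧
    ∀ {S O : Type*} [MeasurableSpace S] [MeasurableSpace O] (P : HSEPOMDP.POMDP S O A)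
      (p : ℕ → S → Fin A → S) (ds : ℕ) (φ : S → EuclideanSpace ℝ (Fin ds))
      (ψ : (Fin (k + 1) → O) → EuclideanSpace ℝ (Fin d))
      (G : Fin H → Matrix (Fin d) (Fin ds) ℝ) (W : ℝ)
      (amax : (Fin A → ℝ) → Fin A),
      -- deterministic transitions
      P.IsDeterministic p →
      -- linear optimal `Q`-function
      (∀ (h : Fin H) (a : Fin A), ∃ w : EuclideanSpace ℝ (Fin ds),
        ‖w‖ ≤ W ∧ ∀ s, P.qStar p H h s a = inner ℝ w (φ s)) →
      -- optimality gap
      (∀ (h : Fin H) (s : S) (a : Fin A), 0 < P.gap p H h s a → Δ ≤ P.gap p H h s a) →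
      -- left-invertible linear embedding of the `K`-step future
      (∀ h : Fin H, (∃ L : Matrix (Fin ds) (Fin d) ℝ, L * G h = 1) ∧
        ∃ b : Fin k → Fin A, ∀ s,
          ∫ o, ψ o ∂(P.window k h b s) = Matrix.toEuclideanLin (G h) (φ s)) →
      Measurable ψ → (∀ o, ‖ψ o‖ ≤ 1) →
      Θ = W / ⨅ h : Fin H, HSEPOMDP.smallestSingularValue (G h) →
      -- `amax` is a rule for choosing a maximizer
      Measurable amax → (∀ (f : Fin A → ℝ) (a : Fin A), f a ≤ f (amax f)) →
      -- except with probability at most `δ`, the output is optimal and the sample bound holds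
      HSEPOMDP.tapeLaw P H k
        {ω | ¬ ∃ (l : List (Fin A)) (N : ℕ),
          HSEPOMDP.Outputs ⟨lam, ε, M, ψ, amax⟩ ω l N ∧
          P.IsOptimalActions H l ∧
          (N : ℝ) ≤ C * Real.log (2 + H + d * A ^ (k + 1) + Θ + 1 / Δ + Real.log (1 / δ)) ^ q *
            (H ^ 5 * Θ ^ 5 * A ^ (3 * (k + 1) - 1) * d ^ 2 * (1 / Δ) ^ 5 * Real.log (1 / δ))}
        ≤ ENNReal.ofReal δ := by
  refine ⟨2 ^ 31, 4, by norm_num, ?_⟩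
  intro H k d A _ Θ Δ δ hH hd hA hΘ hΔ hΔΘ hδ hδ2
  let R : HSEPOMDP.Regime := ⟨H, k, d, A, Θ, Δ, δ, hH, hd, hA, hΘ, hΔ, hΔΘ, hδ, hδ2⟩
  obtain ⟨lam, ε, M, hlam, hε, hM, hmain⟩ :=
    mainTheorem4_general H k d A Θ Δ δ hH hd hA hΘ hΔ hΔΘ hδ hδ2
  refine ⟨lam, ε, M, hlam, hε, hM, ?_⟩
  intro S O _ _ P p ds φ ψ G W amax hp hlin hgap hobs hψm hψ hΘW _ hamax
  have hfuture : HSEPOMDP.HasLinearFutureQ P p H ψ Θ :=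
    hΘW ▸ HSEPOMDP.HasLinearFutureQ.of_embedding
      (HSEPOMDP.iInf_smallestSingularValue_pos (hΘW ▸ hΘ)) hlin hobs
  refine (measure_mono fun ω => mt ?_).trans (hmain P p ψ amax hp hfuture hgap hψm hψ hamax)
  rintro ⟨l, N, hrun, hopt, hN⟩
  exact ⟨l, N, hrun, hopt, hN.trans R.rate_le⟩
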